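/- Let $(K,\prec)$ be an abstract elementary class with amalgamation, joint embedding and no maximal models, and work inside its monster model $\mathfrak C$, the union of a strictly increasing continuous chain $(\mathfrak C_i)_{i\in\mathrm{OR}}$ of models in which $\mathfrak C_{i+1}$ is universal over $\mathfrak C_i$: every $M'\succ\mathfrak C_i$ with $\|M'\|<\|\mathfrak C_i\|^+$ embeds into $\mathfrak C_{i+1}$ over $\mathfrak C_i$. Sets are (set-sized) subsets of $\mathfrak C$, models are $M\prec\mathfrak C$ in $K$. For sequences (of elements or sets) write $f:\bar a\equiv_C\bar b$ if $f\in\mathrm{Aut}(\mathfrak C)$ fixes $C$ pointwise and sends $\bar a$ to $\bar b$ termwise, and $\bar a\equiv_C\bar b$ if such an $f$ exists; the type of $\bar a$ over $C$ is its $\equiv_C$-class. An *independence relation* is a set of triples $(A,M,N)$, written $A\perp_M N$, with $A$ a set and $M\prec N$ models, that is invariant under $\mathrm{Aut}(\mathfrak C)$, monotone (if $A\perp_M N$, $A'\subseteq A$, $M\prec N'\prec N$, then $A'\perp_M N'$) and base monotone (if $A\perp_M N$, $M\prec M'\prec N$, then $A\perp_{M'}N$). Fix a regular cardinal $\kappa>\mathrm{LS}(K)$.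 *Coheir* is the relation: $A\perp^{ch}_M N$ iff $M\prec N$ and for every $A^-\subseteq A$ with $|A^-|<\kappa$ and every $N^-\prec N$ with $\|N^-\|<\kappa$ there is $B^-\subseteq M$ with $B^-\equiv_{N^-}A^-$. Assume: * $K$ is fully $(<\kappa)$-tame: if $\bar a,\bar b$ are sequences of the same (arbitrary) length, $M$ is a model and $\bar a\not\equiv_M\bar b$, then $\bar a\not\equiv_{M_0}\bar b$ for some $M_0\prec M$ with $\|M_0\|<\kappa$. * $K$ is fully $(<\kappa)$-type short: if $\bar a=(a_i)_{i\in I}$, $\bar b=(b_i)_{i\in I}$, $M$ is a model and $\bar a\not\equiv_M\bar b$, then $(a_i)_{i\in I_0}\not\equiv_M(b_i)_{i\in I_0}$ for some $I_0\subseteq I$ with $|I_0|<\kappa$. * $K$ does not have the weak $\kappa$-order property, i.e. there are no $\alpha,\beta<\kappa$, model $M$ with $\|M\|<\kappa$, types $p\ne q$ of length $\alpha+\beta$ over $M$ and sequences $(\bar a_i)_{i<\kappa}$, $(\bar b_i)_{i<\kappa}$ of tuples of lengths $\alpha$, $\beta$ such that for all $i,j<\kappa$ the tuple $\bar a_i\bar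 b_j$ realizes $q$ if $i\le j$ and realizes $p$ if $i>j$. * $\perp^{ch}$ has $(E)$ for base models in $K_{\ge\kappa}$ (the models of size at least $\kappa$). Then: 1. $\perp^{ch}$ has $(C)_\kappa$, $(T)$, $(T_*)$, $(S)$, $(U)$ and $(L)$ for base models in $K_{\ge\kappa}$. 2. If $\perp$ is any independence relation with $(E)$ and $(U)$ for base models in $K_{\ge\kappa}$, then $\perp_M=\perp^{ch}_M$ for every $M\in K_{\ge\kappa}$. Here the properties of a relation $\perp$ for base models in $K_{\ge\kappa}$ are as follows; $M$ and $M_0$ range over $K_{\ge\kappa}$. * $(E)$: $A\perp_M M$ for every set $A$; and if $M\prec N\prec N'$ and $A\perp_M N$, there is $A'\equiv_N A$ with $A'\perp_M N'$. * $(C)_\kappa$: if $A\not\perp_M N$ (where $M\prec N$), there are $A^-\subseteq A$ and $B^-\subseteq N$ of size $<\kappa$ such that $A^-\not\perp_M N_0$ for every $N_0\succ M$ containing $B^-$. * $(T)$: if $M_0\prec M_1\prec M_2$, $M_1\perp_{M_0}N$ and $M_2\perp_{M_1}N$, then $M_2\perp_{M_0}N$. * $(T_*)$: if $M_0\prec M_1\prec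 M_2$, $A\perp_{M_0}M_1$ and $A\perp_{M_1}M_2$, then $A\perp_{M_0}M_2$. * $(S)$: if $A\perp_M N$, there is $M'\succ M$ with $A\subseteq M'$ and $N\perp_M M'$; if $A$ is a model extending $M$, one can take $M'=A$. * $(U)$: if $A\perp_M N$, $A'\perp_M N$ and $f:A\equiv_M A'$, there is $g:A\equiv_N A'$ with $g\restriction A=f\restriction A$. * $(L)$: for every cardinal $\alpha$ there is a regular cardinal $\lambda$ such that for every regular $\mu\ge\lambda$, every increasing continuous chain $(M_i)_{i\le\mu}$ of models in $K_{\ge\kappa}$ and every set $A$ with $|A|=\alpha$, there is $i<\mu$ with $A\perp_{M_i}M_\mu$. -/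

import Mathlib

open scoped FirstOrder Cardinal

universe u v

/-- An abstract elementary class in the language `L`: a class of `L`-structures (`Mem`) together
with the strong substructure relation. `Strong S`, for a substructure `S` of `N`, says that
`S` and `N` are in the class and `S ≺ N`. Sets are the members of `Type u`. -/
structure AbstractElementaryClass (L : FirstOrder.Language.{u, u}) where
  /-- `M` belongs to the class. -/
  Mem : ∀ (M : Type u) [L.Structure M], Prop
  /-- `S ≺ N`. -/
  Strong : ∀ {N : Type u} [L.Structure N], L.Substructure N → Prop
  /-- The class is closed under isomorphisms. -/
  mem_iso : ∀ {M N : Type u} [L.Structure M] [L.Structure N], (M ≃[L] N) → Mem M → Mem N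
  /-- The relation `≺` is closed under isomorphisms. -/
  strong_iso : ∀ {M N : Type u} [L.Structure M] [L.Structure N] (e : M ≃[L] N)
    (S : L.Substructure M), Strong S → Strong (S.map e.toHom)
  mem_of_strong : ∀ {N : Type u} [L.Structure N] (S : L.Substructure N), Strong S → Mem N
  mem_of_strong' : ∀ {N : Type u} [L.Structure N] (S : L.Substructure N), Strong S → Mem S
  /-- `≺` is reflexive on the class. -/
  strong_refl : ∀ {N : Type u} [L.Structure N], Mem N → Strong (⊤ : L.Substructure N)
  /-- `≺` is transitive. -/
  strong_trans : ∀ {N : Type u} [L.Structure N] (S : L.Substructure N) (T : L.Substructure S),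
    Strong S → Strong T → Strong (T.map S.subtype.toHom)
  /-- Coherence: if `S ⊆ T`, `S ≺ N` and `T ≺ N`, then `S ≺ T`. -/
  coherence : ∀ {N : Type u} [L.Structure N] (S T : L.Substructure N), S ≤ T →
    Strong S → Strong T → Strong (S.comap T.subtype.toHom)
  /-- First Tarski-Vaught chain axiom: the union of a `≺`-increasing chain (indexed by a nonempty
  well-ordered set) is in the class, and every member of the chain is strong in the union. -/
  chain_union : ∀ {N : Type u} [L.Structure N] {ι : Type u} [LinearOrder ι] [WellFoundedLT ι]
    [Nonempty ι] (S : ι → L.Substructure N), Monotone S → (∀ i, Mem (S i)) →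
    (∀ i j, i ≤ j → Strong ((S i).comap (S j).subtype.toHom)) → (⨆ i, S i) = ⊤ →
    Mem N ∧ ∀ i, Strong (S i)
  /-- Second Tarski-Vaught chain axiom (smoothness): if all members of an increasing chain are
  strong in `N`, then so is their union. -/
  chain_smooth : ∀ {N : Type u} [L.Structure N] {ι : Type u} [LinearOrder ι] [WellFoundedLT ι]
    [Nonempty ι] (S : ι → L.Substructure N), Monotone S → (∀ i, Strong (S i)) →
    Strong (⨆ i, S i)
  /-- The Löwenheim-Skolem-Tarski axiom. -/
  exists_LS : ∃ l : Cardinal.{u}, ℵ₀ ≤ l ∧ L.card ≤ l ∧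
    ∀ {N : Type u} [L.Structure N], Mem N → ∀ A : Set N,
      ∃ S : L.Substructure N, Strong S ∧ A ⊆ S ∧ #S ≤ #A + l

namespace AbstractElementaryClass

variable {L : FirstOrder.Language.{u, u}} (K : AbstractElementaryClass L)

/-- The Löwenheim-Skolem-Tarski number `LS(K)`. -/
noncomputable def LS : Cardinal.{u} :=
  sInf {l : Cardinal.{u} | ℵ₀ ≤ l ∧ L.card ≤ l ∧
    ∀ {N : Type u} [L.Structure N], K.Mem N → ∀ A : Set N,
      ∃ S : L.Substructure N, K.Strong S ∧ A ⊆ S ∧ #S ≤ #A + l}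

/-- `f` is a `K`-embedding: an isomorphism onto a strong substructure. -/
def IsKEmbedding {M N : Type u} [L.Structure M] [L.Structure N] (f : M ↪[L] N) : Prop :=
  K.Strong f.toHom.range

/-- The amalgamation property. -/
def Amalgamation : Prop :=
  ∀ (M N₁ N₂ : Type u) [L.Structure M] [L.Structure N₁] [L.Structure N₂]
    (f₁ : M ↪[L] N₁) (f₂ : M ↪[L] N₂), K.IsKEmbedding f₁ → K.IsKEmbedding f₂ →
    ∃ (P : Type u) (_ : L.Structure P) (g₁ : N₁ ↪[L] P) (g₂ : N₂ ↪[L] P),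
      K.IsKEmbedding g₁ ∧ K.IsKEmbedding g₂ ∧ ∀ x, g₁ (f₁ x) = g₂ (f₂ x)

/-- The joint embedding property. -/
def JointEmbedding : Prop :=
  ∀ (N₁ N₂ : Type u) [L.Structure N₁] [L.Structure N₂], K.Mem N₁ → K.Mem N₂ →
    ∃ (P : Type u) (_ : L.Structure P) (g₁ : N₁ ↪[L] P) (g₂ : N₂ ↪[L] P),
      K.IsKEmbedding g₁ ∧ K.IsKEmbedding g₂

/-- There are no maximal models: every model has a proper strong extension. -/
def NoMaximalModels : Prop :=
  ∀ (M : Type u) [L.Structure M], K.Mem M →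
    ∃ (N : Type u) (_ : L.Structure N) (f : M ↪[L] N),
      K.IsKEmbedding f ∧ ¬ Function.Surjective f

/-- `S ≺ T` for substructures `S`, `T` of a structure `X` in an arbitrary universe; `T` (hence
also `S`) is isomorphic to a structure in `Type u`, where `≺` is evaluated. -/
def StrongIn {X : Type v} [L.Structure X] (S T : L.Substructure X) : Prop :=
  ∃ (N : Type u) (_ : L.Structure N) (e : N ↪[L] X) (S' : L.Substructure N),
    K.Strong S' ∧ e.toHom.range = T ∧ S'.map e.toHom = S

section StrongInFacts

variable {K} {X : Type v} [L.Structure X]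

theorem exists_equiv_of_range {N : Type u} [L.Structure N] (e : N ↪[L] X)
    (T : L.Substructure X) (h : e.toHom.range = T) :
    ∃ i : N ≃[L] T, ∀ x, (i x : X) = e x := by
  subst h
  exact ⟨e.equivRange, fun x => e.equivRange_apply x⟩

theorem exists_equiv_of_ranges {N N' : Type u} [L.Structure N] [L.Structure N']
    (e : N ↪[L] X) (e' : N' ↪[L] X) (h : e.toHom.range = e'.toHom.range) :
    ∃ i : N ≃[L] N', ∀ x, e' (i x) = e x := by
  obtain ⟨i, hi⟩ := exists_equiv_of_range e _ h
  obtain ⟨j, hj⟩ := exists_equiv_of_range e' _ rfl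
  refine ⟨j.symm.comp i, fun x => ?_⟩
  rw [← hj, ← hi]
  simp

/-- `StrongIn` does not depend on the chosen copy of `T`. -/
theorem StrongIn.strong_comap {S T : L.Substructure X} (h : K.StrongIn S T) {N : Type u}
    [L.Structure N] (e : N ↪[L] X) (he : e.toHom.range = T) : K.Strong (S.comap e.toHom) := by
  obtain ⟨N₁, _, e₁, S₁, hS₁, hT, rfl⟩ := h
  obtain ⟨i, hi⟩ := exists_equiv_of_ranges e₁ e (hT.trans he.symm)
  have : (S₁.map e₁.toHom).comap e.toHom = S₁.map i.toHom := by
    ext x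
    obtain ⟨y, rfl⟩ := i.surjective x
    simp only [FirstOrder.Language.Substructure.mem_comap,
      FirstOrder.Language.Substructure.mem_map]
    constructor
    · rintro ⟨z, hz, hzy⟩
      exact ⟨z, hz, e.injective ((hi z).trans hzy)⟩
    · rintro ⟨z, hz, hzy⟩
      exact ⟨z, hz, (hi z).symm.trans (congrArg e hzy)⟩
  rw [this]
  exact K.strong_iso i S₁ hS₁

theorem StrongIn.trans {S T U : L.Substructure X} (h : K.StrongIn S T) (h' : K.StrongIn T U) :
    K.StrongIn S U := by
  obtain ⟨N, _, e, T', hT', hU, rfl⟩ := h'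
  have hr : (e.comp T'.subtype).toHom.range = T'.map e.toHom := by
    ext x
    simp [FirstOrder.Language.Hom.mem_range, FirstOrder.Language.Substructure.mem_map]
  refine ⟨N, _, e, _, K.strong_trans T' _ hT' (h.strong_comap (e.comp T'.subtype) hr), hU, ?_⟩
  obtain ⟨N₁, _, e₁, S₁, hS₁, hT, rfl⟩ := h
  ext x
  simp only [FirstOrder.Language.Substructure.mem_comap,
      FirstOrder.Language.Substructure.mem_map]
  constructor
  · rintro ⟨_, ⟨y, hy, rfl⟩, rfl⟩
    exact hy
  · rintro ⟨z, hz, rfl⟩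
    have : e₁.toHom z ∈ T'.map e.toHom := hT ▸ ⟨z, rfl⟩
    obtain ⟨y, hy, hyz⟩ := this
    exact ⟨y, ⟨⟨y, hy⟩, ⟨z, hz, hyz.symm⟩, rfl⟩, hyz⟩

theorem StrongIn.coherence {S T U : L.Substructure X} (hST : S ≤ T) (h : K.StrongIn S U)
    (h' : K.StrongIn T U) : K.StrongIn S T := by
  obtain ⟨N, _, e, T', hT', hU, rfl⟩ := h'
  have hle : S.comap e.toHom ≤ T' := by
    intro x hx
    obtain ⟨y, hy, hyx⟩ := hST hx
    exact e.injective hyx ▸ hy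
  refine ⟨T', _, e.comp T'.subtype, _, K.coherence _ T' hle (h.strong_comap e hU) hT', ?_, ?_⟩
  · ext x
    simp [FirstOrder.Language.Hom.mem_range, FirstOrder.Language.Substructure.mem_map]
  · ext x
    simp only [FirstOrder.Language.Substructure.mem_comap,
      FirstOrder.Language.Substructure.mem_map]
    constructor
    · rintro ⟨y, hy, rfl⟩
      exact hy
    · intro hx
      obtain ⟨y, hy, rfl⟩ := hST hx
      exact ⟨⟨y, hy⟩, hx, rfl⟩

end StrongInFacts

/-- `T` is a universal extension of `S`: every strong extension `M'` of (a copy `M` of) `S` with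
`‖M'‖ < ‖M‖⁺` is `K`-embeddable into `T` over `S`. -/
def UniversalOver {X : Type v} [L.Structure X] (S T : L.Substructure X) : Prop :=
  ∀ (M M' : Type u) [L.Structure M] [L.Structure M'] (e : M ↪[L] X) (f : M ↪[L] M'),
    e.toHom.range = S → K.IsKEmbedding f → #M' < Order.succ #M →
    ∃ h : M' ↪[L] X, K.StrongIn h.toHom.range T ∧ ∀ x, h (f x) = e x

/-- A monster model of `K`: the union of a strictly increasing continuous chain, indexed by all
ordinals of the universe `u`, in which each successor is universal over its predecessor.
It is a proper class from the point of view of `Type u`. -/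
structure MonsterModel where
  /-- The underlying class. -/
  carrier : Type (u + 1)
  [str : L.Structure carrier]
  /-- The chain. -/
  chain : Ordinal.{u} → L.Substructure carrier
  strictMono : StrictMono chain
  strong : ∀ i j, i ≤ j → K.StrongIn (chain i) (chain j)
  continuous : ∀ i, Order.IsSuccLimit i → chain i = ⨆ j : Set.Iio i, chain j
  universal : ∀ i, K.UniversalOver (chain i) (chain (Order.succ i))
  union : (⨆ i, chain i) = ⊤

attribute [instance] MonsterModel.str

namespace MonsterModel

variable {K} (C : K.MonsterModel)

/-- `M` is a model inside the monster model `C`, i.e. a (set-sized) `M ∈ K` with `M ≺ C`. -/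
def IsModel (M : L.Substructure C.carrier) : Prop :=
  ∃ i, K.StrongIn M (C.chain i)

/-- The models inside the monster model. By coherence `M ≤ N` is the same as `M ≺ N`; see
`MonsterModel.Model.strongIn_of_le`. -/
abbrev Model : Type (u + 1) := {M : L.Substructure C.carrier // C.IsModel M}

/-- For models inside the monster model, inclusion is the relation `≺`. -/
theorem Model.strongIn_of_le {C : K.MonsterModel} {M N : C.Model} (h : M ≤ N) :
    K.StrongIn M.1 N.1 := by
  obtain ⟨i, hi⟩ := M.2
  obtain ⟨j, hj⟩ := N.2
  exact StrongIn.coherence h (hi.trans (C.strong i (max i j) (le_max_left i j)))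
    (hj.trans (C.strong j (max i j) (le_max_right i j)))

/-- The underlying set of a model. -/
def Model.set {C : K.MonsterModel} (M : C.Model) : Set C.carrier := (M.1 : Set C.carrier)

/-- `f` fixes `B` pointwise. The automorphisms of the monster model are its `L`-automorphisms:
such an `f` maps unboundedly many members of the chain onto themselves, so it
automatically preserves models and `≺`. -/
def Fixes {C : K.MonsterModel} (f : C.carrier ≃[L] C.carrier) (B : Set C.carrier) : Prop :=
  ∀ x ∈ B, f x = x

/-- `A ≡_B A'` for sets. -/
def SetEquivOver (B A A' : Set C.carrier) : Prop :=
  ∃ f : C.carrier ≃[L] C.carrier, Fixes f B ∧ f '' A = A'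

/-- `a ≡_B a'` for sequences, i.e. equality of the Galois types of `a` and `a'` over `B`. -/
def TupleEquivOver {ι : Type u} (B : Set C.carrier) (a a' : ι → C.carrier) : Prop :=
  ∃ f : C.carrier ≃[L] C.carrier, Fixes f B ∧ ∀ i, f (a i) = a' i

/-- `K` is fully `(<κ)`-tame: types of any length over models are determined by their
restrictions to submodels of size `< κ`. -/
def FullyTame (κ : Cardinal.{u}) : Prop :=
  ∀ (ι : Type u) (a b : ι → C.carrier) (M : C.Model), ¬ C.TupleEquivOver M.set a b →
    ∃ M₀ : C.Model, M₀ ≤ M ∧ #M₀.set < Cardinal.lift.{u + 1} κ ∧ ¬ C.TupleEquivOver M₀.set a b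

/-- `K` is fully `(<κ)`-type short: types over models are determined by their restrictions to
subsequences of length `< κ`. -/
def FullyTypeShort (κ : Cardinal.{u}) : Prop :=
  ∀ (ι : Type u) (a b : ι → C.carrier) (M : C.Model), ¬ C.TupleEquivOver M.set a b →
    ∃ I₀ : Set ι, #I₀ < κ ∧
      ¬ C.TupleEquivOver M.set (fun i : I₀ => a i) (fun i : I₀ => b i)

/-- The weak `κ`-order property: there are a model `M` of size `< κ`, lengths `α, β < κ`,
distinct types `p ≠ q` of length `α + β` over `M` (given by realizations), and sequences
`(a_i)_{i < κ}`, `(b_i)_{i < κ}` of tuples of length `α`, `β` such that `a_i b_j` realizes `q` if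
`i ≤ j` and `p` if `j < i`. -/
def WeakOrderProperty (κ : Cardinal.{u}) : Prop :=
  ∃ (α β : Type u) (M : C.Model) (p q : α ⊕ β → C.carrier)
    (a : Ordinal.{u} → α → C.carrier) (b : Ordinal.{u} → β → C.carrier),
    #α < κ ∧ #β < κ ∧ #M.set < Cardinal.lift.{u + 1} κ ∧ ¬ C.TupleEquivOver M.set p q ∧
    ∀ i < κ.ord, ∀ j < κ.ord,
      (i ≤ j → C.TupleEquivOver M.set (Sum.elim (a i) (b j)) q) ∧
      (j < i → C.TupleEquivOver M.set (Sum.elim (a i) (b j)) p)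

/-- Ternary relations "`A` is independent from `N` over `M`". -/
abbrev TernaryRel : Type (u + 1) := Set C.carrier → C.Model → C.Model → Prop

/-- `R` is an independence relation: a relation on triples `(A, M, N)`, where `A` is a set
(a `u`-small subset of the monster model) and `M ≺ N` are models, which satisfies invariance,
left and right monotonicity and base monotonicity. -/
structure IsIndependenceRelation (R : C.TernaryRel) : Prop where
  dom : ∀ {A M N}, R A M N → Small.{u} A ∧ M ≤ N
  invariance : ∀ {A M N A' M' N'} (f : C.carrier ≃[L] C.carrier),
    f '' A = A' → f '' M.set = M'.set → f '' N.set = N'.set → (R A M N ↔ R A' M' N')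
  monotonicity : ∀ {A A' M N N'}, R A M N → A' ⊆ A → M ≤ N' → N' ≤ N → R A' M N'
  base_monotonicity : ∀ {A M M' N}, R A M N → M ≤ M' → M' ≤ N → R A M' N

/-- Coheir (`(<κ)`-satisfiability). -/
def Coheir (κ : Cardinal.{u}) : C.TernaryRel := fun A M N =>
  Small.{u} A ∧ M ≤ N ∧
    ∀ A₀ : Set C.carrier, A₀ ⊆ A → #A₀ < Cardinal.lift.{u + 1} κ →
    ∀ N₀ : C.Model, N₀ ≤ N → #N₀.set < Cardinal.lift.{u + 1} κ →
      ∃ B₀ : Set C.carrier, B₀ ⊆ M.set ∧ C.SetEquivOver N₀.set B₀ A₀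

/-- The models of size at least `κ`. -/
def ModelsGE (κ : Cardinal.{u}) : Set C.Model :=
  {M | Cardinal.lift.{u + 1} κ ≤ #M.set}

/-! In the following properties of a relation `R`, the base model ranges over a class `𝓑`
of models. -/

variable (R : C.TernaryRel) (𝓑 : Set C.Model)

/-- Continuity `(C)_κ`. -/
def HasContinuity (κ : Cardinal.{u}) : Prop :=
  ∀ (A : Set C.carrier) (M N : C.Model), M ∈ 𝓑 → Small.{u} A → M ≤ N → ¬ R A M N →
    ∃ A₀ B₀ : Set C.carrier, A₀ ⊆ A ∧ B₀ ⊆ N.set ∧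
      #A₀ < Cardinal.lift.{u + 1} κ ∧ #B₀ < Cardinal.lift.{u + 1} κ ∧
      ∀ N₀ : C.Model, M ≤ N₀ → B₀ ⊆ N₀.set → ¬ R A₀ M N₀

/-- Left transitivity `(T)`. -/
def HasLeftTransitivity : Prop :=
  ∀ M₀ M₁ M₂ N : C.Model, M₀ ∈ 𝓑 → M₀ ≤ M₁ → M₁ ≤ M₂ →
    R M₁.set M₀ N → R M₂.set M₁ N → R M₂.set M₀ N

/-- Right transitivity `(T_*)`. -/
def HasRightTransitivity : Prop :=
  ∀ (A : Set C.carrier) (M₀ M₁ M₂ : C.Model), M₀ ∈ 𝓑 → M₀ ≤ M₁ → M₁ ≤ M₂ →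
    R A M₀ M₁ → R A M₁ M₂ → R A M₀ M₂

/-- Symmetry `(S)`. -/
def HasSymmetry : Prop :=
  ∀ (A : Set C.carrier) (M N : C.Model), M ∈ 𝓑 → R A M N →
    (∃ M' : C.Model, M ≤ M' ∧ A ⊆ M'.set ∧ R N.set M M') ∧
    (∀ M' : C.Model, M ≤ M' → A = M'.set → R N.set M M')

/-- Uniqueness `(U)`. -/
def HasUniqueness : Prop :=
  ∀ (A A' : Set C.carrier) (M N : C.Model), M ∈ 𝓑 → R A M N → R A' M N →
    ∀ f : C.carrier ≃[L] C.carrier, Fixes f M.set → f '' A = A' →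
      ∃ g : C.carrier ≃[L] C.carrier, Fixes g N.set ∧ g '' A = A' ∧ ∀ x ∈ A, g x = f x

/-- Existence `(E₀)`. -/
def HasExistence : Prop :=
  ∀ (A : Set C.carrier) (M : C.Model), M ∈ 𝓑 → Small.{u} A → R A M M

/-- Extension `(E₁)`. -/
def HasExtension : Prop :=
  ∀ (A : Set C.carrier) (M N N' : C.Model), M ∈ 𝓑 → M ≤ N → N ≤ N' → R A M N →
    ∃ A' : Set C.carrier, C.SetEquivOver N.set A' A ∧ R A' M N'

/-- The property `(E)`. -/
def HasE : Prop := C.HasExistence R 𝓑 ∧ C.HasExtension R 𝓑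

/-- `M` restricted to the ordinals `i ≤ δ` is an increasing continuous chain of models. -/
def IsContinuousChain (δ : Ordinal.{u}) (M : Ordinal.{u} → C.Model) : Prop :=
  (∀ i j, i ≤ j → j ≤ δ → M i ≤ M j) ∧
  (∀ i ≤ δ, Order.IsSuccLimit i → (M i).1 = ⨆ j : Set.Iio i, (M j).1)

/-- Local character `(L)`: for every cardinal `α` there is a regular `l` such that for every
regular `μ ≥ l`, every increasing continuous chain `(M_i)_{i ≤ μ}` (of base models in `𝓑`) and
every `A` of size `α`, `A` is independent from `M_μ` over `M_i` for some `i < μ`. -/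
def HasLocalCharacter : Prop :=
  ∀ α : Cardinal.{u}, ∃ l : Cardinal.{u}, l.IsRegular ∧
    ∀ μ : Cardinal.{u}, μ.IsRegular → l ≤ μ →
    ∀ M : Ordinal.{u} → C.Model, C.IsContinuousChain μ.ord M → (∀ i < μ.ord, M i ∈ 𝓑) →
    ∀ A : Set C.carrier, #A = Cardinal.lift.{u + 1} α → ∃ i < μ.ord, R A (M i) (M μ.ord)

end MonsterModel

end AbstractElementaryClass

/-! The core is `tupleEquivOver_sumElim_of_coheir`. Suppose the type of `a` over `N` and the type of
`b'` over a model containing `a` are both satisfiable in `M` on small pieces, and `b`, in `N`, has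
the same type over `M` as `b'`. If `ab` and `ab'` had different types over a small model, one could
choose inside `M` alternately copies `a_i` of `a` and `b_i` of `b'`, each over the earlier choices.
The pairs `a_i b_j` would then have the type of `ab` for `i ≤ j` and of `ab'` for `j < i`, which is
the weak order property.

Symmetry over models follows by comparing `N` with a copy supplied by (E) that is independent from
the model on the left. Uniqueness follows from the same comparison made for `A` and for `A'`: the
copy of a small part of `N` can be moved into `M`, where the two types agree by assumption, and
shortness and tameness reduce to small pieces. Right transitivity and symmetry for arbitrary sets
are then formal consequences of extension and uniqueness.

For local character, `Coheir.exists_small_base` closes a submodel `M` of `N` under realizations of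
types over small subsets of an auxiliary model `M'` containing `A`. Then `N` is coheir-independent
from `M'` over `M`, and symmetry turns this around. The bound on the number of types comes from a
set containing a copy of every set of size at most `κ`, which uses universality and homogeneity of
the monster model.

For canonicity, a long chain of independent copies of `N` and local character of coheir show that a
set independent in the sense of `R` is coheir-independent from one of the copies. Uniqueness of `R`
transfers this to `N`. The converse inclusion compares with an `R`-independent copy and uses
uniqueness of coheir. -/

/-- Dependent choice along a well-founded order. -/
theorem exists_wellFounded_rec {ι : Type*} {X : Type*} [Preorder ι] [WellFoundedLT ι] [Nonempty X]
    (P : ∀ i : ι, (∀ j, j < i → X) → X → Prop)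
    (step : ∀ (i : ι) (g : ∀ j, j < i → X),
      (∀ j (hj : j < i), P j (fun k hk => g k (hk.trans hj)) (g j hj)) → ∃ x, P i g x) :
    ∃ f : ι → X, ∀ i, P i (fun j _ => f j) (f i) := by
  classical
  -- `Classical.epsilon` gives an arbitrary value when `P i g` has no solution; the induction below
  -- shows that this case never occurs.
  let F : ∀ i : ι, (∀ j, j < i → X) → X := fun i g => Classical.epsilon (P i g)
  let f : ι → X := (wellFounded_lt (α := ι)).fix F
  have hf : ∀ i, f i = F i (fun j _ => f j) := fun i => WellFounded.fix_eq _ _ _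
  refine ⟨f, fun i => ?_⟩
  induction i using WellFoundedLT.induction with
  | _ i ih =>
    have := Classical.epsilon_spec (step i (fun j _ => f j) (fun j hj => ih j hj))
    rwa [hf i]

namespace AbstractElementaryClass

open FirstOrder.Language

variable {L : FirstOrder.Language.{u, u}} {K : AbstractElementaryClass L}

theorem LS_spec (K : AbstractElementaryClass L) : ℵ₀ ≤ K.LS ∧ L.card ≤ K.LS ∧
    ∀ {N : Type u} [L.Structure N], K.Mem N → ∀ A : Set N,
      ∃ S : L.Substructure N, K.Strong S ∧ A ⊆ S ∧ #S ≤ #A + K.LS :=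
  csInf_mem (s := {l : Cardinal.{u} | ℵ₀ ≤ l ∧ L.card ≤ l ∧
    ∀ {N : Type u} [L.Structure N], K.Mem N → ∀ A : Set N,
      ∃ S : L.Substructure N, K.Strong S ∧ A ⊆ S ∧ #S ≤ #A + l}) K.exists_LS

/-! ### Strong substructures of structures in a larger universe -/

section StrongIn

variable {X : Type v} [L.Structure X]

theorem range_comp_subtype {M N : Type*} [L.Structure M] [L.Structure N] (e : M ↪[L] N)
    (S : L.Substructure M) : (e.comp S.subtype).toHom.range = S.map e.toHom := by
  ext x
  simp [FirstOrder.Language.Hom.mem_range, Substructure.mem_map]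

theorem range_comp_emb {M N P : Type*} [L.Structure M] [L.Structure N] [L.Structure P]
    (e : N ↪[L] P) (f : M ↪[L] N) : (e.comp f).toHom.range = f.toHom.range.map e.toHom := by
  ext x
  simp [FirstOrder.Language.Hom.mem_range, Substructure.mem_map]

theorem Strong.strongIn {N : Type u} [L.Structure N] {S : L.Substructure N} (h : K.Strong S)
    (e : N ↪[L] X) : K.StrongIn (S.map e.toHom) e.toHom.range :=
  ⟨N, _, e, S, h, rfl, rfl⟩

theorem StrongIn.le {S T : L.Substructure X} (h : K.StrongIn S T) : S ≤ T := by
  obtain ⟨N, _, e, S', -, rfl, rfl⟩ := h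
  rintro _ ⟨x, hx, rfl⟩
  exact e.toHom.mem_range_self x

theorem StrongIn.small_right {S T : L.Substructure X} (h : K.StrongIn S T) : Small.{u} T := by
  obtain ⟨N, _, e, S', -, rfl, rfl⟩ := h
  exact small_of_surjective e.equivRange.surjective

theorem StrongIn.small_left {S T : L.Substructure X} (h : K.StrongIn S T) : Small.{u} S := by
  have := h.small_right
  exact small_subset (s := (T : Set X)) (t := (S : Set X)) h.le

theorem StrongIn.exists_copy {S T : L.Substructure X} (h : K.StrongIn S T) :
    ∃ (N : Type u) (_ : L.Structure N) (e : N ↪[L] X), e.toHom.range = S ∧ K.Mem N := by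
  obtain ⟨N, _, e, S', hS, hT, rfl⟩ := h
  exact ⟨S', _, e.comp S'.subtype, range_comp_subtype _ _, K.mem_of_strong' _ hS⟩

theorem StrongIn.map {Y : Type*} [L.Structure Y] {S T : L.Substructure X} (h : K.StrongIn S T)
    (g : X ≃[L] Y) : K.StrongIn (S.map g.toHom) (T.map g.toHom) := by
  obtain ⟨N, _, e, S', hS, rfl, rfl⟩ := h
  refine ⟨N, _, g.toEmbedding.comp e, S', hS, ?_, ?_⟩
  · rw [range_comp_emb]; rfl
  · rw [Substructure.map_map]; rfl

theorem StrongIn.isKEmbedding {N M : Type u} [L.Structure N] [L.Structure M] {e : N ↪[L] X}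
    {e' : M ↪[L] X} (h : K.StrongIn e'.toHom.range e.toHom.range) :
    ∃ j : M ↪[L] N, K.IsKEmbedding j ∧ ∀ x, e (j x) = e' x := by
  have hs := h.strong_comap e rfl
  obtain ⟨i, hi⟩ := exists_equiv_of_ranges e' (e.comp ((e'.toHom.range.comap e.toHom).subtype)) (by
    rw [range_comp_subtype]
    ext x
    constructor
    · intro hx
      obtain ⟨y, -, rfl⟩ := h.le hx
      exact ⟨y, hx, rfl⟩
    · rintro ⟨y, hy, rfl⟩
      exact hy)
  refine ⟨(Substructure.subtype _).comp i.toEmbedding, ?_, hi⟩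
  have : ((Substructure.subtype (e'.toHom.range.comap e.toHom)).comp i.toEmbedding).toHom.range
      = e'.toHom.range.comap e.toHom := by
    ext x
    constructor
    · rintro ⟨y, rfl⟩
      exact (i y).2
    · intro hx
      obtain ⟨y, hy⟩ := i.surjective ⟨x, hx⟩
      exact ⟨y, congrArg Subtype.val hy⟩
  rw [IsKEmbedding, this]
  exact hs

/-- The Löwenheim-Skolem property for a strong substructure of a large structure. -/
theorem StrongIn.exists_LS {X : Type (u + 1)} [L.Structure X] {S T : L.Substructure X}
    (h : K.StrongIn S T) (A : Set X) (hA : A ⊆ S) : ∃ U : L.Substructure X,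
      K.StrongIn U S ∧ A ⊆ U ∧ #U ≤ #A + Cardinal.lift.{u + 1} K.LS := by
  obtain ⟨N, _, e, rfl, hN⟩ := h.exists_copy
  obtain ⟨U, hU, hAU, hc⟩ := K.LS_spec.2.2 hN (e ⁻¹' A)
  refine ⟨U.map e.toHom, hU.strongIn e, ?_, ?_⟩
  · intro x hx
    obtain ⟨y, rfl⟩ := hA hx
    exact ⟨y, hAU hx, rfl⟩
  · have h1 := Cardinal.mk_image_eq_lift.{u, u + 1} e U e.injective
    have h2 := Cardinal.mk_preimage_of_injective_lift.{u, u + 1} e A e.injective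
    rw [Cardinal.lift_id'.{u, u + 1}] at h1 h2
    have h3 := Cardinal.lift_le.{u + 1}.2 hc
    rw [Cardinal.lift_add] at h3
    exact (h1.trans_le h3).trans (add_le_add_left h2 _)

end StrongIn

/-! ### Unions of models, universality and homogeneity of the monster model -/

namespace MonsterModel

variable {L : FirstOrder.Language.{u, u}} {K : AbstractElementaryClass L} {C : K.MonsterModel}

theorem exists_subset_chain (A : Set C.carrier) [Small.{u} A] (i₀ : Ordinal.{u}) :
    ∃ i, i₀ ≤ i ∧ A ⊆ C.chain i := by
  have hmem : ∀ x : C.carrier, ∃ i, x ∈ C.chain i := fun x => by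
    have : x ∈ (⨆ i, C.chain i) := by rw [C.union]; trivial
    rwa [Substructure.mem_iSup_of_directed (Monotone.directed_le C.strictMono.monotone)] at this
  choose idx hidx using hmem
  have : BddAbove (idx '' A) := Ordinal.bddAbove_of_small
  obtain ⟨b, hb⟩ := this
  refine ⟨max i₀ b, le_max_left _ _, fun x hx => ?_⟩
  exact C.strictMono.monotone ((hb ⟨x, hx, rfl⟩).trans (le_max_right _ _)) (hidx x)

theorem IsModel.small {M : L.Substructure C.carrier} (h : C.IsModel M) : Small.{u} M :=
  h.choose_spec.small_left

instance Model.small_set (M : C.Model) : Small.{u} M.set := IsModel.small M.2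

theorem isModel_chain (i : Ordinal.{u}) : C.IsModel (C.chain i) := ⟨i, C.strong i i le_rfl⟩

theorem IsModel.of_strongIn {M N : L.Substructure C.carrier} (h : K.StrongIn M N)
    (hN : C.IsModel N) : C.IsModel M :=
  let ⟨i, hi⟩ := hN; ⟨i, h.trans hi⟩

theorem IsModel.strongIn_of_le {M N : L.Substructure C.carrier} (hM : C.IsModel M)
    (hN : C.IsModel N) (h : M ≤ N) : K.StrongIn M N :=
  Model.strongIn_of_le (M := ⟨M, hM⟩) (N := ⟨N, hN⟩) h

/-- The union of a small chain of models is a model. -/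
theorem isModel_iSup {ι : Type*} [LinearOrder ι] [WellFoundedLT ι] [Nonempty ι] [Small.{u} ι]
    (M : ι → L.Substructure C.carrier) (hM : Monotone M) (h : ∀ i, C.IsModel (M i)) :
    C.IsModel (⨆ i, M i) := by
  have := fun i => (h i).small
  have hs : Small.{u} (⋃ i, (M i : Set C.carrier)) := small_iUnion _
  obtain ⟨k, -, hk⟩ := exists_subset_chain (C := C) (⋃ i, (M i : Set C.carrier)) 0
  have hle : ∀ i, M i ≤ C.chain k := fun i => (Set.subset_iUnion _ i).trans hk
  obtain ⟨N, _, e, he, -⟩ := (C.strong k k le_rfl).exists_copy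
  -- Smoothness speaks of structures and index sets in `Type u`, so the chain is pulled back to a
  -- copy `N` of one member of the monster chain that contains the whole union.
  let S : Shrink.{u} ι → L.Substructure N := fun i => (M ((orderIsoShrink ι).symm i)).comap e.toHom
  have hwf : WellFoundedLT (Shrink.{u} ι) :=
    ⟨((orderIsoShrink.{u} ι).symm.toRelIsoLT.toRelEmbedding.wellFounded wellFounded_lt)⟩
  have : Nonempty (Shrink.{u} ι) := (orderIsoShrink.{u} ι).symm.toEquiv.nonempty
  have hS := K.chain_smooth S
    (fun i j hij => Substructure.monotone_comap (hM ((orderIsoShrink ι).symm.monotone hij)))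
    (fun i => ((h _).strongIn_of_le (isModel_chain k) (hle _)).strong_comap e he)
  refine IsModel.of_strongIn (N := C.chain k) ?_ (isModel_chain k)
  have := hS.strongIn e
  rw [he, Substructure.map_iSup] at this
  convert this using 1
  rw [← (orderIsoShrink.{u} ι).symm.toEquiv.iSup_comp (g := M)]
  congr 1
  ext i x
  constructor
  · intro hx
    have : x ∈ e.toHom.range := he ▸ hle _ hx
    obtain ⟨y, rfl⟩ := this
    exact ⟨y, hx, rfl⟩
  · rintro ⟨y, hy, rfl⟩
    exact hy

/-- Strictness of the chain yields a new element at each step below `c.ord`, and these elements are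
distinct. -/
theorem lift_card_le_chain (c : Cardinal.{u}) {i : Ordinal.{u}} (h : c.ord ≤ i) :
    Cardinal.lift.{u + 1} c ≤ #(C.chain i) := by
  have h1 : ∀ j : Set.Iio c.ord, ∃ x, x ∈ C.chain i ∧ x ∈ C.chain (Order.succ j) ∧
      x ∉ C.chain j.1 := by
    rintro ⟨j, hj⟩
    obtain ⟨x, hx, hx'⟩ := SetLike.exists_of_lt (C.strictMono (Order.lt_succ j))
    exact ⟨x, C.strictMono.monotone ((Order.succ_le_of_lt hj).trans h) hx, hx, hx'⟩
  choose f hf using h1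
  have h2 : Function.Injective (fun j => (⟨f j, (hf j).1⟩ : C.chain i)) := by
    intro j k hjk
    have hjk : f j = f k := congrArg Subtype.val hjk
    by_contra hne
    rcases lt_or_gt_of_ne hne with hlt | hlt
    · exact (hf k).2.2 (C.strictMono.monotone (Order.succ_le_of_lt hlt) (hjk ▸ (hf j).2.1))
    · exact (hf j).2.2 (C.strictMono.monotone (Order.succ_le_of_lt hlt) (hjk ▸ (hf k).2.1))
  have := Cardinal.mk_le_of_injective h2
  rwa [Cardinal.mk_Iio_ordinal, Cardinal.card_ord] at this

/-- The monster model is universal over each of its models. -/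
theorem exists_embedding_over (hAP : K.Amalgamation) {M M' : Type u} [L.Structure M]
    [L.Structure M'] (e : M ↪[L] C.carrier) (f : M ↪[L] M') (he : C.IsModel e.toHom.range)
    (hf : K.IsKEmbedding f) :
    ∃ h : M' ↪[L] C.carrier, C.IsModel h.toHom.range ∧ ∀ x, h (f x) = e x := by
  have := he.small
  -- The stage is taken at least as large as `M'` and `K.LS`. The amalgam of `M'` with it over `M`
  -- then shrinks to a model `Q` of no larger size than the stage, to which universality of the next
  -- stage applies.
  obtain ⟨i, hi, hei⟩ := exists_subset_chain (C := C) (e.toHom.range) (max #M' K.LS).ord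
  obtain ⟨N, _, e₁, he₁, -⟩ := (C.strong i i le_rfl).exists_copy
  obtain ⟨j, hj, hje⟩ := (he₁.symm ▸ he.strongIn_of_le (isModel_chain i) hei :
    K.StrongIn e.toHom.range e₁.toHom.range).isKEmbedding
  obtain ⟨P, _, g₁, g₂, hg₁, hg₂, hg⟩ := hAP M M' N f j hf hj
  obtain ⟨Q, hQ, hgQ, hcQ⟩ := K.LS_spec.2.2 (K.mem_of_strong _ hg₁) (Set.range g₁ ∪ Set.range g₂)
  have hN : max #M' K.LS ≤ #N := by
    have h1 := lift_card_le_chain (C := C) _ hi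
    rw [← he₁] at h1
    have h2 := Cardinal.mk_congr_lift.{u, u + 1} e₁.equivRange.toEquiv
    rw [Cardinal.lift_id'.{u, u + 1}] at h2
    exact Cardinal.lift_le.1 (h2 ▸ h1)
  have hinf : ℵ₀ ≤ #N := K.LS_spec.1.trans ((le_max_right _ _).trans hN)
  have hQN : #Q < Order.succ #N := by
    rw [Order.lt_succ_iff]
    refine hcQ.trans (Cardinal.add_le_of_le hinf ((Cardinal.mk_union_le _ _).trans
      (Cardinal.add_le_of_le hinf ?_ Cardinal.mk_range_le)) ((le_max_right _ _).trans hN))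
    exact Cardinal.mk_range_le.trans ((le_max_left _ _).trans hN)
  have hm₁ : ∀ x, g₁ x ∈ Q := fun x => hgQ (Or.inl ⟨x, rfl⟩)
  have hm₂ : ∀ x, g₂ x ∈ Q := fun x => hgQ (Or.inr ⟨x, rfl⟩)
  have hK : ∀ {A : Type u} [L.Structure A] (g : A ↪[L] P) (hm : ∀ x, g x ∈ Q),
      K.IsKEmbedding g → K.IsKEmbedding (g.codRestrict Q hm) := by
    intro A _ g hm hg
    have := K.coherence g.toHom.range Q (by rintro _ ⟨x, rfl⟩; exact hm x) hg hQ
    rw [IsKEmbedding]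
    convert this using 1
    ext x
    constructor
    · rintro ⟨y, rfl⟩
      exact ⟨y, rfl⟩
    · rintro ⟨y, hy⟩
      exact ⟨y, Subtype.ext hy⟩
  obtain ⟨h, hh, hhe⟩ := C.universal i N Q e₁ (g₂.codRestrict Q hm₂) he₁ (hK _ _ hg₂) hQN
  refine ⟨h.comp (g₁.codRestrict Q hm₁), ?_, fun x => ?_⟩
  · rw [range_comp_emb]
    exact IsModel.of_strongIn (Strong.strongIn (hK _ _ hg₁) h)
      (IsModel.of_strongIn hh (isModel_chain _))
  · rw [← hje, ← hhe]
    exact congrArg h (Subtype.ext (hg x))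

/-- The partial automorphisms used to show homogeneity of the monster model. -/
def IsModelEquiv (f : C.carrier ≃ₚ[L] C.carrier) : Prop :=
  C.IsModel f.dom ∧ C.IsModel f.cod

/-- The "forth" half of a back-and-forth: a stage containing the domain is embedded over the range
of `f`, with the domain embedded through `f`. -/
theorem IsModelEquiv.exists_chain_le_dom (hAP : K.Amalgamation) {f : C.carrier ≃ₚ[L] C.carrier}
    (hf : IsModelEquiv f) (i : Ordinal.{u}) :
    ∃ g, f ≤ g ∧ IsModelEquiv g ∧ C.chain i ≤ g.dom := by
  have := hf.1.small
  obtain ⟨k, hik, hk⟩ := exists_subset_chain (C := C) f.dom i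
  obtain ⟨M, _, e, he, -⟩ := (hf.1.strongIn_of_le hf.1 le_rfl).exists_copy
  obtain ⟨N, _, e₁, he₁, -⟩ := (C.strong k k le_rfl).exists_copy
  obtain ⟨j, hj, hje⟩ := (he.symm ▸ he₁.symm ▸ hf.1.strongIn_of_le (isModel_chain k) hk :
    K.StrongIn e.toHom.range e₁.toHom.range).isKEmbedding
  obtain ⟨iM, hiM⟩ := exists_equiv_of_range e _ he
  let e' : M ↪[L] C.carrier := f.toEmbedding.comp iM.toEmbedding
  have he' : e'.toHom.range = f.cod := by
    ext x
    constructor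
    · rintro ⟨y, rfl⟩
      exact (f.toEquiv (iM y)).2
    · intro hx
      obtain ⟨y, hy⟩ := f.toEquiv.surjective ⟨x, hx⟩
      obtain ⟨z, rfl⟩ := iM.surjective y
      exact ⟨z, congrArg Subtype.val hy⟩
  obtain ⟨h, hh, hhe⟩ := exists_embedding_over hAP e' j (he'.symm ▸ hf.2) hj
  obtain ⟨iN, hiN⟩ := exists_equiv_of_range e₁ _ he₁
  refine ⟨⟨C.chain k, h.toHom.range, h.equivRange.comp iN.symm⟩, ?_, ⟨isModel_chain k, hh⟩,
    C.strictMono.monotone hik⟩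
  refine ⟨hk, ?_⟩
  ext x
  obtain ⟨y, rfl⟩ := iM.surjective x
  have h1 : Substructure.inclusion hk (iM y) = iN (j y) := by
    apply Subtype.ext
    rw [hiN, hje, ← hiM]
    rfl
  change ((h.equivRange (iN.symm (Substructure.inclusion hk (iM y))) : _) : C.carrier) =
    f.toEquiv (iM y)
  rw [h1, FirstOrder.Language.Equiv.symm_apply_apply,
    FirstOrder.Language.Embedding.equivRange_apply, hhe]
  rfl

theorem IsModelEquiv.exists_chain_le (hAP : K.Amalgamation) {f : C.carrier ≃ₚ[L] C.carrier}
    (hf : IsModelEquiv f) (i : Ordinal.{u}) :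
    ∃ g, f ≤ g ∧ IsModelEquiv g ∧ C.chain i ≤ g.dom ∧ C.chain i ≤ g.cod := by
  obtain ⟨g, hfg, hg, hi⟩ := hf.exists_chain_le_dom hAP i
  obtain ⟨h, hgh, hh, hi'⟩ := (show IsModelEquiv g.symm from ⟨hg.2, hg.1⟩).exists_chain_le_dom hAP i
  exact ⟨h.symm, hfg.trans (PartialEquiv.symm_le_symm hgh), ⟨hh.2, hh.1⟩,
    hi.trans (PartialEquiv.cod_le_cod hgh), hi'⟩

/-- Homogeneity of the monster model. -/
theorem IsModelEquiv.exists_extension (hAP : K.Amalgamation) {f : C.carrier ≃ₚ[L] C.carrier}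
    (hf : IsModelEquiv f) :
    ∃ F : C.carrier ≃[L] C.carrier, ∀ x : f.dom, F x = f.toEquiv x := by
  obtain ⟨F, hF⟩ := exists_wellFounded_rec (ι := Ordinal.{u}) (X := C.carrier ≃ₚ[L] C.carrier)
    (fun i g x => f ≤ x ∧ IsModelEquiv x ∧ C.chain i ≤ x.dom ∧ C.chain i ≤ x.cod ∧
      ∀ j hj, g j hj ≤ x) (by
    intro i g hg
    rcases Set.eq_empty_or_nonempty (Set.Iio i) with hi | ⟨j₀, hj₀⟩
    · obtain ⟨x, hx⟩ := hf.exists_chain_le hAP i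
      exact ⟨x, hx.1, hx.2.1, hx.2.2.1, hx.2.2.2, fun j hj => absurd hj (hi ▸ id : j ∉ Set.Iio i)⟩
    · have : Nonempty (Set.Iio i) := ⟨⟨j₀, hj₀⟩⟩
      -- The earlier maps form a chain whose union is again an isomorphism of models; it is extended
      -- once more to absorb stage `i` on both sides.
      let S : Set.Iio i →o C.carrier ≃ₚ[L] C.carrier := ⟨fun j => g j.1 j.2, by
        rintro ⟨j, hj⟩ ⟨k, hk⟩ hjk
        rcases eq_or_lt_of_le hjk with h | h
        · cases h; exact le_rfl
        · exact (hg k hk).2.2.2.2 j h⟩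
      have hS : IsModelEquiv (FirstOrder.Language.DirectLimit.partialEquivLimit S) :=
        ⟨isModel_iSup _ (fun a b h => PartialEquiv.dom_le_dom (S.monotone h))
          (fun j => (hg j.1 j.2).2.1.1),
         isModel_iSup _ (fun a b h => PartialEquiv.cod_le_cod (S.monotone h))
          (fun j => (hg j.1 j.2).2.1.2)⟩
      obtain ⟨x, hx⟩ := hS.exists_chain_le hAP i
      have hSx : ∀ j hj, g j hj ≤ x := fun j hj =>
        (FirstOrder.Language.DirectLimit.le_partialEquivLimit S ⟨j, hj⟩).trans hx.1
      exact ⟨x, (hg j₀ hj₀).1.trans (hSx j₀ hj₀), hx.2.1, hx.2.2.1, hx.2.2.2, hSx⟩)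
  have hmono : Monotone F := fun i j hij => by
    rcases eq_or_lt_of_le hij with rfl | h
    · exact le_rfl
    · exact (hF j).2.2.2.2 i h
  let G := FirstOrder.Language.DirectLimit.partialEquivLimit ⟨F, hmono⟩
  have hd : G.dom = ⊤ := top_unique (C.union ▸ iSup_mono fun i => (hF i).2.2.1)
  have hc : G.cod = ⊤ := top_unique (C.union ▸ iSup_mono fun i => (hF i).2.2.2.1)
  have hfG : f ≤ G := (hF 0).1.trans
    (FirstOrder.Language.DirectLimit.le_partialEquivLimit (⟨F, hmono⟩ : _ →o _) 0)
  refine ⟨PartialEquiv.toEquivOfEqTop hd hc, fun x => ?_⟩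
  have h1 : PartialEquiv.toEquivOfEqTop hd hc x = PartialEquiv.toEmbeddingOfEqTop hd x := by
    rw [← PartialEquiv.toEquivOfEqTop_toEmbedding hd hc]; rfl
  rw [h1, PartialEquiv.toEmbeddingOfEqTop_apply]
  exact congrArg Subtype.val (PartialEquiv.toEquiv_inclusion_apply hfG x)

/-! ### The action of automorphisms on models -/

/-- Every automorphism maps unboundedly many members of the chain onto themselves. -/
theorem exists_map_chain_eq (g : C.carrier ≃[L] C.carrier) (i : Ordinal.{u}) :
    ∃ δ, i ≤ δ ∧ (C.chain δ).map g.toHom = C.chain δ := by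
  have step : ∀ j : Ordinal.{u}, ∃ k, j < k ∧ (∀ x ∈ C.chain j, g x ∈ C.chain k) ∧
      ∀ x ∈ C.chain j, g.symm x ∈ C.chain k := by
    intro j
    have := (isModel_chain (C := C) j).small
    have hs : Small.{u} ((C.chain j : Set C.carrier)) := this
    obtain ⟨k, hjk, hk⟩ := exists_subset_chain (C := C)
      (g '' (C.chain j) ∪ g.symm '' (C.chain j)) (Order.succ j)
    exact ⟨k, Order.succ_le_iff.1 hjk, fun x hx => hk (Or.inl ⟨x, hx, rfl⟩),
      fun x hx => hk (Or.inr ⟨x, hx, rfl⟩)⟩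
  choose s hs hsg hsg' using step
  -- Closing off `ω` times under `g` and its inverse reaches a limit `δ`; by continuity every
  -- element of stage `δ` already lies in some stage `t n`.
  let t : ℕ → Ordinal.{u} := fun n => s^[n] i
  have ht : ∀ n, t (n + 1) = s (t n) := fun n => Function.iterate_succ_apply' s n i
  have htlt : ∀ n, t n < t (n + 1) := fun n => ht n ▸ hs _
  have hb : BddAbove (Set.range t) := Ordinal.bddAbove_of_small
  let δ := ⨆ n, t n
  have hle : ∀ n, t n ≤ δ := fun n => le_ciSup hb n
  have hlt : ∀ n, t n < δ := fun n => (htlt n).trans_le (hle _)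
  have hex : ∀ j < δ, ∃ n, j < t n := fun j hj => exists_lt_of_lt_ciSup hj
  have hlim : Order.IsSuccLimit δ := by
    refine ⟨fun hm => (hlt 0).not_ge (hm (hlt 0).le), Order.isSuccPrelimit_of_succ_lt ?_⟩
    intro j hj
    obtain ⟨n, hn⟩ := hex j hj
    exact (Order.succ_le_of_lt hn).trans_lt (hlt n)
  have hmem : ∀ x, x ∈ C.chain δ → ∃ n, x ∈ C.chain (t n) := by
    intro x hx
    rw [C.continuous δ hlim] at hx
    have : Nonempty (Set.Iio δ) := ⟨⟨t 0, hlt 0⟩⟩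
    obtain ⟨⟨j, hj⟩, hx⟩ := (Substructure.mem_iSup_of_directed
      (S := fun j : Set.Iio δ => C.chain j)
      (Monotone.directed_le fun a b h => C.strictMono.monotone h)).1 hx
    obtain ⟨n, hn⟩ := hex j hj
    exact ⟨n, C.strictMono.monotone hn.le hx⟩
  refine ⟨δ, hle 0, ?_⟩
  ext x
  constructor
  · rintro ⟨y, hy, rfl⟩
    obtain ⟨n, hn⟩ := hmem y hy
    have := hsg _ y hn
    rw [← ht] at this
    exact C.strictMono.monotone (hle _) this
  · intro hx
    obtain ⟨n, hn⟩ := hmem x hx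
    have := hsg' _ x hn
    rw [← ht] at this
    exact ⟨g.symm x, C.strictMono.monotone (hle _) this, g.apply_symm_apply x⟩

/-- A stage containing `M` that `g` maps onto itself bounds the image as well. -/
theorem IsModel.map {M : L.Substructure C.carrier} (h : C.IsModel M)
    (g : C.carrier ≃[L] C.carrier) : C.IsModel (M.map g.toHom) := by
  obtain ⟨i, hi⟩ := h
  obtain ⟨δ, hδ, hg⟩ := exists_map_chain_eq g i
  exact ⟨δ, hg ▸ (hi.trans (C.strong i δ hδ)).map g⟩

/-- The image of a model under an automorphism. -/
def Model.map (g : C.carrier ≃[L] C.carrier) (M : C.Model) : C.Model :=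
  ⟨M.1.map g.toHom, M.2.map g⟩

@[simp]
theorem Model.map_set (g : C.carrier ≃[L] C.carrier) (M : C.Model) :
    (M.map g).set = g '' M.set := rfl

theorem Model.set_subset {M N : C.Model} : M.set ⊆ N.set ↔ M ≤ N := Iff.rfl

theorem Model.set_injective {M N : C.Model} (h : M.set = N.set) : M = N :=
  le_antisymm (Model.set_subset.1 h.subset) (Model.set_subset.1 h.superset)

theorem Model.map_mono (g : C.carrier ≃[L] C.carrier) {M N : C.Model} (h : M ≤ N) :
    M.map g ≤ N.map g :=
  Model.set_subset.1 (Set.image_mono h)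

theorem image_of_fixes {g : C.carrier ≃[L] C.carrier} {B : Set C.carrier} (h : Fixes g B) :
    g '' B = B := by
  ext x
  constructor
  · rintro ⟨y, hy, rfl⟩
    rwa [h y hy]
  · exact fun hx => ⟨x, hx, h x hx⟩

theorem Model.map_of_fixes {g : C.carrier ≃[L] C.carrier} {M : C.Model} (h : Fixes g M.set) :
    M.map g = M :=
  Model.set_injective (image_of_fixes h)

theorem Fixes.symm {g : C.carrier ≃[L] C.carrier} {B : Set C.carrier} (h : Fixes g B) :
    Fixes g.symm B := fun x hx => by
  conv_lhs => rw [← h x hx]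
  exact g.symm_apply_apply x

theorem symm_image_image (g : C.carrier ≃[L] C.carrier) (A : Set C.carrier) :
    g.symm '' (g '' A) = A := by
  rw [Set.image_image]
  simp

/-! ### Small models, enumerations and cardinal bounds -/

theorem exists_model_superset (A : Set C.carrier) [Small.{u} A] (M : C.Model) :
    ∃ N : C.Model, M ≤ N ∧ A ⊆ N.set := by
  obtain ⟨i, -, hi⟩ := exists_subset_chain (C := C) (A ∪ M.set) 0
  exact ⟨⟨_, isModel_chain i⟩, Model.set_subset.1 (Set.subset_union_right.trans hi),
    Set.subset_union_left.trans hi⟩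

theorem exists_model_LS (N : C.Model) {A : Set C.carrier} (hA : A ⊆ N.set) :
    ∃ M : C.Model, M ≤ N ∧ A ⊆ M.set ∧ #M.set ≤ #A + Cardinal.lift.{u + 1} K.LS := by
  obtain ⟨U, hU, hAU, hc⟩ := (N.2.strongIn_of_le N.2 le_rfl).exists_LS A hA
  exact ⟨⟨U, IsModel.of_strongIn hU N.2⟩, hU.le, hAU, hc⟩

theorem exists_model_lt {κ : Cardinal.{u}} (hLS : K.LS < κ) (N : C.Model) {A : Set C.carrier}
    (hA : A ⊆ N.set) (hc : #A < Cardinal.lift.{u + 1} κ) :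
    ∃ M : C.Model, M ≤ N ∧ A ⊆ M.set ∧ #M.set < Cardinal.lift.{u + 1} κ := by
  obtain ⟨M, hM, hAM, hcM⟩ := exists_model_LS N hA
  refine ⟨M, hM, hAM, hcM.trans_lt (Cardinal.add_lt_of_lt ?_ hc (Cardinal.lift_lt.2 hLS))⟩
  exact Cardinal.aleph0_le_lift.2 (K.LS_spec.1.trans hLS.le)

theorem small_of_card_le {X : Type (u + 1)} {A : Set X} {c : Cardinal.{u}}
    (h : #A ≤ Cardinal.lift.{u + 1} c) : Small.{u} A := by
  obtain ⟨d, hd⟩ := Cardinal.mem_range_lift_of_le h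
  rw [← d.mk_out, ← Cardinal.mk_uLift, Cardinal.eq] at hd
  exact ⟨d.out, ⟨hd.some.symm.trans Equiv.ulift⟩⟩

theorem exists_enumeration (A : Set C.carrier) [Small.{u} A] :
    ∃ (α : Type u) (a : α → C.carrier), Set.range a = A ∧ Cardinal.lift.{u + 1} #α = #A := by
  refine ⟨Shrink.{u} A, fun x => ((equivShrink A).symm x : C.carrier), ?_, ?_⟩
  · ext x
    constructor
    · rintro ⟨y, rfl⟩
      exact Subtype.prop _
    · exact fun hx => ⟨equivShrink A ⟨x, hx⟩, by simp⟩
  · have := Cardinal.mk_congr_lift.{u, u + 1} (equivShrink.{u} A).symm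
    rwa [Cardinal.lift_id'.{u, u + 1}] at this

theorem card_range_lt {α : Type u} (a : α → C.carrier) {κ : Cardinal.{u}} (h : #α < κ) :
    #(Set.range a) < Cardinal.lift.{u + 1} κ := by
  have := Cardinal.mk_range_le_lift.{u, u + 1} (f := a)
  rw [Cardinal.lift_id'.{u, u + 1}] at this
  exact this.trans_lt (Cardinal.lift_lt.2 h)

theorem card_iUnion_Iio_lt {κ : Cardinal.{u}} (hreg : κ.IsRegular) {i : Ordinal.{u}}
    (hi : i < κ.ord) (s : ∀ j, j < i → Set C.carrier)
    (hs : ∀ j hj, #(s j hj) < Cardinal.lift.{u + 1} κ) :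
    #(⋃ (j) (hj), s j hj) < Cardinal.lift.{u + 1} κ := by
  have h1 : (⋃ (j) (hj), s j hj) = ⋃ j : Set.Iio i, s j.1 j.2 := by
    ext x; simp
  rw [h1, Cardinal.card_iUnion_lt_iff_forall_of_isRegular (Cardinal.isRegular_lift_iff.2 hreg)]
  · exact fun j => hs j.1 j.2
  · rw [Cardinal.mk_Iio_ordinal, Cardinal.lift_lt]
    exact Cardinal.lt_ord.1 hi

/-! ### Calculus of types of tuples -/

namespace TupleEquivOver

variable {α β : Type u} {B D : Set C.carrier} {a a' a'' : α → C.carrier} {b b' : β → C.carrier}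

theorem refl (B : Set C.carrier) (a : α → C.carrier) : C.TupleEquivOver B a a :=
  ⟨FirstOrder.Language.Equiv.refl L _, fun _ _ => rfl, fun _ => rfl⟩

theorem symm (h : C.TupleEquivOver B a a') : C.TupleEquivOver B a' a := by
  obtain ⟨f, hf, hfa⟩ := h
  exact ⟨f.symm, Fixes.symm hf, fun i => by rw [← hfa i, f.symm_apply_apply]⟩

theorem trans (h : C.TupleEquivOver B a a') (h' : C.TupleEquivOver B a' a'') :
    C.TupleEquivOver B a a'' := by
  obtain ⟨f, hf, hfa⟩ := h
  obtain ⟨g, hg, hga⟩ := h'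
  refine ⟨g.comp f, fun x hx => ?_, fun i => ?_⟩
  · rw [FirstOrder.Language.Equiv.comp_apply, hf x hx, hg x hx]
  · rw [FirstOrder.Language.Equiv.comp_apply, hfa, hga]

theorem mono (h : C.TupleEquivOver D a a') (hBD : B ⊆ D) : C.TupleEquivOver B a a' := by
  obtain ⟨f, hf, hfa⟩ := h
  exact ⟨f, fun x hx => hf x (hBD hx), hfa⟩

theorem sumElim_right (h : C.TupleEquivOver D b b') (hBD : B ⊆ D) (ha : ∀ i, a i ∈ D) :
    C.TupleEquivOver B (Sum.elim a b) (Sum.elim a b') := by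
  obtain ⟨f, hf, hfa⟩ := h
  refine ⟨f, fun x hx => hf x (hBD hx), ?_⟩
  rintro (i | i)
  · exact hf _ (ha i)
  · exact hfa i

theorem sumElim_left (h : C.TupleEquivOver D a a') (hBD : B ⊆ D) (hb : ∀ i, b i ∈ D) :
    C.TupleEquivOver B (Sum.elim a b) (Sum.elim a' b) := by
  obtain ⟨f, hf, hfa⟩ := h
  refine ⟨f, fun x hx => hf x (hBD hx), ?_⟩
  rintro (i | i)
  · exact hfa i
  · exact hf _ (hb i)

end TupleEquivOver

/-! ### Coheir and the order property -/

/-- Types of tuples in `A` are realized in `M` when `A` is coheir-independent. -/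
theorem Coheir.exists_realization {κ : Cardinal.{u}} (hLS : K.LS < κ) {A : Set C.carrier}
    {M N : C.Model} (h : C.Coheir κ A M N) {α : Type u} {a : α → C.carrier} (ha : ∀ i, a i ∈ A)
    (hα : #α < κ) {D : Set C.carrier} (hD : D ⊆ N.set) (hc : #D < Cardinal.lift.{u + 1} κ) :
    ∃ a' : α → C.carrier, (∀ i, a' i ∈ M.set) ∧ C.TupleEquivOver D a' a := by
  obtain ⟨N₀, hN₀, hDN, hcN⟩ := exists_model_lt hLS N hD hc
  obtain ⟨B, hB, f, hf, hfB⟩ := h.2.2 (Set.range a) (by rintro _ ⟨i, rfl⟩; exact ha i)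
    (card_range_lt a hα) N₀ hN₀ hcN
  refine ⟨fun i => f.symm (a i), fun i => hB ?_, f, fun x hx => hf x (hDN hx), fun i => ?_⟩
  · obtain ⟨y, hy, hya⟩ : a i ∈ f '' B := hfB ▸ ⟨i, rfl⟩
    change f.symm (a i) ∈ B
    rwa [← hya, f.symm_apply_apply]
  · exact f.apply_symm_apply _

/-- Failure of the weak order property forces the types of two coheir-independent positions of a
tuple to agree. -/
theorem tupleEquivOver_sumElim_of_coheir {κ : Cardinal.{u}} (hreg : κ.IsRegular)
    (hLS : K.LS < κ) (hord : ¬ C.WeakOrderProperty κ) {A B : Set C.carrier} {M M₀ N N' : C.Model}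
    (hA : C.Coheir κ A M N) (hB : C.Coheir κ B M N') {α β : Type u} (hα : #α < κ) (hβ : #β < κ)
    {a : α → C.carrier} {b b' : β → C.carrier} (ha : ∀ i, a i ∈ A) (hb : ∀ i, b i ∈ N.set)
    (hb' : ∀ i, b' i ∈ B) (haN' : ∀ i, a i ∈ N'.set) (hbb' : C.TupleEquivOver M.set b b')
    (hM₀ : M₀ ≤ M) (hcM₀ : #M₀.set < Cardinal.lift.{u + 1} κ) :
    C.TupleEquivOver M₀.set (Sum.elim a b) (Sum.elim a b') := by
  by_contra hne
  apply hord
  have hinf : ℵ₀ ≤ Cardinal.lift.{u + 1} κ := Cardinal.aleph0_le_lift.2 hreg.aleph0_le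
  have : Nonempty ((α → C.carrier) × (β → C.carrier)) := ⟨(a, b)⟩
  -- Stage `i` first picks `a_i` in `M` like `a` over `b` and the earlier `b_j`, then `b_i` in `M`
  -- like `b'` over `a`, the earlier `a_j` and also `a_i` itself. Regularity of `κ` keeps the
  -- parameter sets small.
  obtain ⟨F, hF⟩ := exists_wellFounded_rec (ι := Ordinal.{u})
    (X := (α → C.carrier) × (β → C.carrier))
    (fun i g x => i < κ.ord → (∀ k, x.1 k ∈ M.set) ∧ (∀ k, x.2 k ∈ M.set) ∧
      C.TupleEquivOver (M₀.set ∪ Set.range b ∪ ⋃ (j) (hj), Set.range (g j hj).2) x.1 a ∧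
      C.TupleEquivOver (M₀.set ∪ Set.range a ∪ Set.range x.1 ∪ ⋃ (j) (hj), Set.range (g j hj).1)
        x.2 b') (by
    intro i g hg
    by_cases hi : i < κ.ord
    swap
    · exact ⟨(a, b), fun h => absurd h hi⟩
    have hM₀N : M₀.set ⊆ N.set := hM₀.trans hA.2.1
    have hM₀N' : M₀.set ⊆ N'.set := hM₀.trans hB.2.1
    obtain ⟨a', ha'M, ha'⟩ := hA.exists_realization hLS ha hα
      (D := M₀.set ∪ Set.range b ∪ ⋃ (j) (hj), Set.range (g j hj).2) (by
        refine Set.union_subset (Set.union_subset hM₀N (Set.range_subset_iff.2 hb)) ?_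
        exact Set.iUnion₂_subset fun j hj => Set.range_subset_iff.2 fun k =>
          hA.2.1 ((hg j hj (hj.trans hi)).2.1 k))
      ((Cardinal.mk_union_le _ _).trans_lt (Cardinal.add_lt_of_lt hinf
        ((Cardinal.mk_union_le _ _).trans_lt (Cardinal.add_lt_of_lt hinf hcM₀
          (card_range_lt b hβ))) (card_iUnion_Iio_lt hreg hi _ fun j hj => card_range_lt _ hβ)))
    obtain ⟨b₁, hb₁M, hb₁⟩ := hB.exists_realization hLS hb' hβ
      (D := M₀.set ∪ Set.range a ∪ Set.range a' ∪ ⋃ (j) (hj), Set.range (g j hj).1) (by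
        refine Set.union_subset (Set.union_subset (Set.union_subset hM₀N'
          (Set.range_subset_iff.2 haN')) (Set.range_subset_iff.2 fun k => hB.2.1 (ha'M k))) ?_
        exact Set.iUnion₂_subset fun j hj => Set.range_subset_iff.2 fun k =>
          hB.2.1 ((hg j hj (hj.trans hi)).1 k))
      ((Cardinal.mk_union_le _ _).trans_lt (Cardinal.add_lt_of_lt hinf
        ((Cardinal.mk_union_le _ _).trans_lt (Cardinal.add_lt_of_lt hinf
          ((Cardinal.mk_union_le _ _).trans_lt (Cardinal.add_lt_of_lt hinf hcM₀
            (card_range_lt a hα))) (card_range_lt a' hα)))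
        (card_iUnion_Iio_lt hreg hi _ fun j hj => card_range_lt _ hα)))
    exact ⟨(a', b₁), fun _ => ⟨ha'M, hb₁M, ha', hb₁⟩⟩)
  refine ⟨α, β, M₀, Sum.elim a b', Sum.elim a b, fun i => (F i).1, fun i => (F i).2, hα, hβ, hcM₀,
    fun h => hne h.symm, fun i hi j hj => ⟨fun hij => ?_, fun hji => ?_⟩⟩
  -- For `i ≤ j`, replace `b_j` by `b'`, then `b'` by `b` because `a_i` lies in `M`, then `a_i` by
  -- `a`. The diagonal case is why `a_i` is among the parameters of `b_i`.
  · have h1 : C.TupleEquivOver M₀.set (Sum.elim (F i).1 (F j).2) (Sum.elim (F i).1 b') := by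
      refine (hF j hj).2.2.2.sumElim_right (fun x hx => Or.inl (Or.inl (Or.inl hx))) fun k => ?_
      rcases eq_or_lt_of_le hij with rfl | hij
      · exact Or.inl (Or.inr ⟨k, rfl⟩)
      · exact Or.inr (Set.mem_iUnion₂.2 ⟨i, hij, k, rfl⟩)
    have h2 : C.TupleEquivOver M₀.set (Sum.elim (F i).1 b') (Sum.elim (F i).1 b) :=
      hbb'.symm.sumElim_right hM₀ (hF i hi).1
    have h3 : C.TupleEquivOver M₀.set (Sum.elim (F i).1 b) (Sum.elim a b) :=
      (hF i hi).2.2.1.sumElim_left (fun x hx => Or.inl (Or.inl hx)) fun k =>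
        Or.inl (Or.inr ⟨k, rfl⟩)
    exact h1.trans (h2.trans h3)
  · have h1 : C.TupleEquivOver M₀.set (Sum.elim (F i).1 (F j).2) (Sum.elim a (F j).2) :=
      (hF i hi).2.2.1.sumElim_left (fun x hx => Or.inl (Or.inl hx)) fun k =>
        Or.inr (Set.mem_iUnion₂.2 ⟨j, hji, k, rfl⟩)
    have h2 : C.TupleEquivOver M₀.set (Sum.elim a (F j).2) (Sum.elim a b') :=
      (hF j hj).2.2.2.sumElim_right (fun x hx => Or.inl (Or.inl (Or.inl hx))) fun k =>
        Or.inl (Or.inl (Or.inr ⟨k, rfl⟩))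
    exact h1.trans h2

variable {κ : Cardinal.{u}}

theorem ModelsGE.mono {M N : C.Model} (h : M ∈ C.ModelsGE κ) (hMN : M ≤ N) :
    N ∈ C.ModelsGE κ :=
  le_trans (show _ ≤ _ from h) (Cardinal.mk_le_mk_of_subset (Model.set_subset.2 hMN))

theorem TupleEquivOver.setEquivOver {α : Type u} {B : Set C.carrier} {a a' : α → C.carrier}
    (h : C.TupleEquivOver B a a') : C.SetEquivOver B (Set.range a) (Set.range a') := by
  obtain ⟨f, hf, hfa⟩ := h
  refine ⟨f, hf, ?_⟩
  rw [← Set.range_comp]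
  exact congrArg Set.range (funext hfa)

theorem TupleEquivOver.of_sumElim_right {α β : Type u} {B : Set C.carrier}
    {a a' : α → C.carrier} {b : β → C.carrier}
    (h : C.TupleEquivOver B (Sum.elim a b) (Sum.elim a' b)) :
    C.TupleEquivOver (Set.range b) a a' := by
  obtain ⟨f, -, hf⟩ := h
  refine ⟨f, ?_, fun i => hf (Sum.inl i)⟩
  rintro _ ⟨i, rfl⟩
  exact hf (Sum.inr i)

theorem TupleEquivOver.of_sumElim_left {α β : Type u} {B : Set C.carrier}
    {a : α → C.carrier} {b b' : β → C.carrier}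
    (h : C.TupleEquivOver B (Sum.elim a b) (Sum.elim a b')) :
    C.TupleEquivOver (Set.range a) b b' := by
  obtain ⟨f, -, hf⟩ := h
  refine ⟨f, ?_, fun i => hf (Sum.inr i)⟩
  rintro _ ⟨i, rfl⟩
  exact hf (Sum.inl i)

theorem SetEquivOver.trans {B A A' A'' : Set C.carrier} (h : C.SetEquivOver B A A')
    (h' : C.SetEquivOver B A' A'') : C.SetEquivOver B A A'' := by
  obtain ⟨f, hf, rfl⟩ := h
  obtain ⟨g, hg, rfl⟩ := h'
  refine ⟨g.comp f, fun x hx => ?_, ?_⟩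
  · rw [FirstOrder.Language.Equiv.comp_apply, hf x hx, hg x hx]
  · rw [Set.image_image]; rfl

theorem small_of_card_lt {A : Set C.carrier} (h : #A < Cardinal.lift.{u + 1} κ) : Small.{u} A :=
  small_of_card_le h.le

theorem exists_enumeration_lt {A : Set C.carrier} (h : #A < Cardinal.lift.{u + 1} κ) :
    ∃ (α : Type u) (a : α → C.carrier), Set.range a = A ∧ #α < κ := by
  have := small_of_card_lt h
  obtain ⟨α, a, ha, hc⟩ := exists_enumeration A
  exact ⟨α, a, ha, Cardinal.lift_lt.1 (hc.trans_lt h)⟩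

theorem exists_small_model (hreg : κ.IsRegular) (hLS : K.LS < κ) (M : C.Model) :
    ∃ M₀ : C.Model, M₀ ≤ M ∧ #M₀.set < Cardinal.lift.{u + 1} κ := by
  obtain ⟨M₀, h, -, hc⟩ := exists_model_lt hLS M (A := ∅) (Set.empty_subset _) (by
    rw [Cardinal.mk_eq_zero]
    exact Cardinal.aleph0_pos.trans_le (Cardinal.aleph0_le_lift.2 hreg.aleph0_le))
  exact ⟨M₀, h, hc⟩

/-! ### Formal properties of coheir and of independence relations -/

theorem Coheir.image {A : Set C.carrier} {M N M' N' : C.Model} (h : C.Coheir κ A M N)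
    (f : C.carrier ≃[L] C.carrier) (hM : f '' M.set = M'.set) (hN : f '' N.set = N'.set) :
    C.Coheir κ (f '' A) M' N' := by
  have := h.1
  refine ⟨small_image _ _, ?_, fun A₀ hA₀ hc N₀ hN₀ hcN => ?_⟩
  · rw [← Model.set_subset, ← hM, ← hN]
    exact Set.image_mono h.2.1
  have hinj : Function.Injective f.symm := f.symm.injective
  obtain ⟨B, hB, g, hg, hgB⟩ := h.2.2 (f.symm '' A₀)
    (by rw [← symm_image_image f A]; exact Set.image_mono hA₀)
    (by rwa [Cardinal.mk_image_eq hinj]) (N₀.map f.symm)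
    (by
      rw [← Model.set_subset, Model.map_set, ← symm_image_image f N.set, hN]
      exact Set.image_mono hN₀)
    (by rwa [Model.map_set, Cardinal.mk_image_eq hinj])
  refine ⟨f '' B, hM ▸ Set.image_mono hB, f.comp (g.comp f.symm), fun x hx => ?_, ?_⟩
  · exact (congrArg f (hg _ ⟨x, hx, rfl⟩)).trans (f.apply_symm_apply x)
  · have : f '' (f.symm '' A₀) = A₀ := by rw [Set.image_image]; simp
    rw [← this, ← hgB, Set.image_image, Set.image_image]
    simp

theorem isIndependenceRelation_coheir : C.IsIndependenceRelation (C.Coheir κ) where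
  dom h := ⟨h.1, h.2.1⟩
  invariance := by
    rintro A M N _ M' N' f rfl hM hN
    refine ⟨fun h => h.image f hM hN, fun h => ?_⟩
    have := h.image f.symm (M' := M) (N' := N) (by rw [← hM, symm_image_image])
      (by rw [← hN, symm_image_image])
    rwa [symm_image_image] at this
  monotonicity {A A' M N N'} h hA hM hN := by
    have := h.1
    exact ⟨small_subset hA, hM, fun A₀ hA₀ hc N₀ hN₀ => h.2.2 A₀ (hA₀.trans hA) hc N₀ (hN₀.trans hN)⟩
  base_monotonicity {A M M' N} h hM hN := ⟨h.1, hN, fun A₀ hA₀ hc N₀ hN₀ hcN =>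
    let ⟨B, hB, hBA⟩ := h.2.2 A₀ hA₀ hc N₀ hN₀ hcN
    ⟨B, hB.trans hM, hBA⟩⟩

theorem IsIndependenceRelation.map {R : C.TernaryRel} (hR : C.IsIndependenceRelation R)
    {A : Set C.carrier} {M N : C.Model} (h : R A M N) (f : C.carrier ≃[L] C.carrier) :
    R (f '' A) (M.map f) (N.map f) :=
  (hR.invariance f rfl rfl rfl).1 h

/-- Every small set has an independent copy. -/
theorem HasE.exists_copy {R : C.TernaryRel} {𝓑 : Set C.Model} (hE : C.HasE R 𝓑)
    (A : Set C.carrier) [hA : Small.{u} A] {M N : C.Model} (hM : M ∈ 𝓑) (hMN : M ≤ N) :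
    ∃ f : C.carrier ≃[L] C.carrier, Fixes f M.set ∧ R (f '' A) M N := by
  obtain ⟨A', ⟨g, hg, rfl⟩, h⟩ := hE.2 A M M N hM le_rfl hMN (hE.1 A M hM hA)
  exact ⟨g.symm, Fixes.symm hg, by rwa [symm_image_image]⟩

/-- Extension and uniqueness yield right transitivity. -/
theorem IsIndependenceRelation.hasRightTransitivity {R : C.TernaryRel}
    (hR : C.IsIndependenceRelation R) (hE : C.HasE R (C.ModelsGE κ))
    (hU : C.HasUniqueness R (C.ModelsGE κ)) : C.HasRightTransitivity R (C.ModelsGE κ) := by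
  intro A M₀ M₁ M₂ hM₀ h₀₁ h₁₂ h h'
  -- The extension `A'` is independent from `M₂` over `M₁` by base monotonicity, so uniqueness over
  -- `M₁` identifies it with `A` over `M₂`.
  obtain ⟨A', ⟨f, hf, rfl⟩, hA'⟩ := hE.2 A M₀ M₁ M₂ hM₀ h₀₁ h₁₂ h
  obtain ⟨g, hg, hgA, -⟩ := hU _ _ M₁ M₂ (ModelsGE.mono hM₀ h₀₁)
    (hR.base_monotonicity hA' h₀₁ h₁₂) h' f hf rfl
  have := hR.map hA' g
  rwa [hgA, Model.map_of_fixes hg, Model.map_of_fixes (fun x hx => hg x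
    ((h₀₁.trans h₁₂ : M₀ ≤ M₂) hx))] at this

/-- A failure is witnessed by a small `A₀` and a small model `N₀`, which by coherence is a strong
submodel of every model containing it. -/
theorem coheir_hasContinuity (𝓑 : Set C.Model) : C.HasContinuity (C.Coheir κ) 𝓑 κ := by
  intro A M N _ hA hMN h
  have : ∃ A₀ ⊆ A, #A₀ < Cardinal.lift.{u + 1} κ ∧ ∃ N₀ : C.Model, N₀ ≤ N ∧
      #N₀.set < Cardinal.lift.{u + 1} κ ∧
      ¬ ∃ B₀ : Set C.carrier, B₀ ⊆ M.set ∧ C.SetEquivOver N₀.set B₀ A₀ := by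
    by_contra hcon
    push Not at hcon
    refine h ⟨hA, hMN, fun A₀ hA₀ hc N₀ hN₀ hcN => ?_⟩
    obtain ⟨B, hB⟩ := hcon A₀ hA₀ hc N₀ hN₀ hcN
    exact ⟨B, hB⟩
  obtain ⟨A₀, hA₀, hc, N₀, hN₀, hcN, hB⟩ := this
  exact ⟨A₀, N₀.set, hA₀, Model.set_subset.2 hN₀, hc, hcN, fun N' _ hN' h' =>
    hB (h'.2.2 A₀ subset_rfl hc N₀ (Model.set_subset.1 hN') hcN)⟩

/-- A small subset of `M₂` is copied into `M₁` and that copy into `M₀`, over the same small model.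
-/
theorem coheir_hasLeftTransitivity (𝓑 : Set C.Model) :
    C.HasLeftTransitivity (C.Coheir κ) 𝓑 := by
  intro M₀ M₁ M₂ N _ _ _ h₁ h₂
  refine ⟨h₂.1, h₁.2.1, fun A₀ hA₀ hc N₀ hN₀ hcN => ?_⟩
  obtain ⟨B, hB, hBA⟩ := h₂.2.2 A₀ hA₀ hc N₀ hN₀ hcN
  have hcB : #B = #A₀ := by
    obtain ⟨f, -, rfl⟩ := hBA
    exact (Cardinal.mk_image_eq f.injective).symm
  obtain ⟨D, hD, hDB⟩ := h₁.2.2 B hB (hcB ▸ hc) N₀ hN₀ hcN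
  exact ⟨D, hD, hDB.trans hBA⟩

/-! ### Symmetry and uniqueness -/

/-- Symmetry of coheir for models. -/
theorem Coheir.symm_of_model (hreg : κ.IsRegular) (hLS : K.LS < κ)
    (hord : ¬ C.WeakOrderProperty κ) (hE : C.HasE (C.Coheir κ) (C.ModelsGE κ))
    {M M' N : C.Model} (hM : M ∈ C.ModelsGE κ) (hMM' : M ≤ M') (h : C.Coheir κ M'.set M N) :
    C.Coheir κ N.set M M' := by
  refine ⟨inferInstance, hMM', fun B₀ hB₀ hcB M₁ hM₁ hcM₁ => ?_⟩
  obtain ⟨f, hf, hfN⟩ := hE.exists_copy N.set hM hMM'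
  obtain ⟨α, a, ha, hα⟩ := exists_enumeration_lt hcM₁
  obtain ⟨β, b, hb, hβ⟩ := exists_enumeration_lt hcB
  obtain ⟨M₀, hM₀, hcM₀⟩ := exists_small_model hreg hLS M
  have haM : ∀ i, a i ∈ M'.set := fun i => hM₁ (ha ▸ ⟨i, rfl⟩ : a i ∈ M₁.set)
  have hbN : ∀ i, b i ∈ N.set := fun i => hB₀ (hb ▸ ⟨i, rfl⟩)
  -- Thus `b` and its independent copy `f b` have the same type over `M₁`, and the latter type is
  -- realized in `M`. The model `M₀` only serves as the small base in the order property.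
  have h1 := tupleEquivOver_sumElim_of_coheir hreg hLS hord h hfN hα hβ haM hbN
    (b' := fun i => f (b i)) (fun i => ⟨_, hbN i, rfl⟩) haM ⟨f, hf, fun _ => rfl⟩ hM₀ hcM₀
  obtain ⟨b', hb', hbb'⟩ := hfN.exists_realization hLS (a := fun i => f (b i))
    (fun i => ⟨_, hbN i, rfl⟩) hβ hM₁ hcM₁
  have h2 := hbb'.trans (ha ▸ h1.of_sumElim_left.symm : C.TupleEquivOver M₁.set _ b)
  exact ⟨Set.range b', Set.range_subset_iff.2 hb', hb ▸ h2.setEquivOver⟩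

/-- With `b` enumerating a small part of `N` and `g b` a copy independent from both sides, `b` may
be replaced by `g b` next to `a` and next to `f a`. A realization `b'` of the type of `g b` in `M`
is fixed by `f`, which links the two sides. -/
theorem coheir_hasUniqueness (hreg : κ.IsRegular) (hLS : K.LS < κ)
    (htame : C.FullyTame κ) (hshort : C.FullyTypeShort κ)
    (hord : ¬ C.WeakOrderProperty κ) (hE : C.HasE (C.Coheir κ) (C.ModelsGE κ)) :
    C.HasUniqueness (C.Coheir κ) (C.ModelsGE κ) := by
  rintro A _ M N hM h h' f hf rfl
  have := h.1
  have := h'.1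
  obtain ⟨ι, a, ha, -⟩ := exists_enumeration A
  suffices hs : C.TupleEquivOver N.set a (fun i => f (a i)) by
    obtain ⟨g, hg, hga⟩ := hs
    have hgf : ∀ x ∈ A, g x = f x := by
      rw [← ha]
      rintro _ ⟨i, rfl⟩
      exact hga i
    exact ⟨g, hg, Set.image_congr hgf, hgf⟩
  by_contra hne
  obtain ⟨I, hI, hne⟩ := hshort _ _ _ _ hne
  obtain ⟨N₀, hN₀, hcN₀, hne⟩ := htame _ _ _ _ hne
  apply hne
  obtain ⟨β, b, hb, hβ⟩ := exists_enumeration_lt hcN₀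
  obtain ⟨M₀, hM₀, hcM₀⟩ := exists_small_model hreg hLS M
  obtain ⟨N', hN', hAN'⟩ := exists_model_superset (A ∪ f '' A) M
  obtain ⟨g, hg, hgN⟩ := hE.exists_copy N.set hM hN'
  have haA : ∀ i : I, a i ∈ A := fun i => ha ▸ ⟨i.1, rfl⟩
  have hfaA : ∀ i : I, f (a i) ∈ f '' A := fun i => ⟨_, haA i, rfl⟩
  have haN' : ∀ i : I, a i ∈ N'.set := fun i => hAN' (Or.inl (haA i))
  have hfaN' : ∀ i : I, f (a i) ∈ N'.set := fun i => hAN' (Or.inr (hfaA i))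
  have hbN : ∀ i, b i ∈ N.set := fun i => hN₀ (hb ▸ ⟨i, rfl⟩ : b i ∈ N₀.set)
  have hgb : ∀ i, g (b i) ∈ g '' N.set := fun i => ⟨_, hbN i, rfl⟩
  have h1 := tupleEquivOver_sumElim_of_coheir hreg hLS hord h hgN hI hβ haA hbN hgb haN'
    ⟨g, hg, fun _ => rfl⟩ hM₀ hcM₀
  have h2 := tupleEquivOver_sumElim_of_coheir hreg hLS hord h' hgN hI hβ hfaA hbN hgb hfaN'
    ⟨g, hg, fun _ => rfl⟩ hM₀ hcM₀
  have hinf : ℵ₀ ≤ Cardinal.lift.{u + 1} κ := Cardinal.aleph0_le_lift.2 hreg.aleph0_le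
  obtain ⟨b', hb', hbb'⟩ := hgN.exists_realization hLS hgb hβ
    (D := M₀.set ∪ Set.range (fun i : I => a i) ∪ Set.range (fun i : I => f (a i)))
    (Set.union_subset (Set.union_subset (hM₀.trans hN') (Set.range_subset_iff.2 haN'))
      (Set.range_subset_iff.2 hfaN'))
    ((Cardinal.mk_union_le _ _).trans_lt (Cardinal.add_lt_of_lt hinf
      ((Cardinal.mk_union_le _ _).trans_lt (Cardinal.add_lt_of_lt hinf hcM₀
        (card_range_lt _ hI))) (card_range_lt _ hI)))
  have h3 : C.TupleEquivOver M₀.set (Sum.elim (fun i : I => a i) b')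
      (Sum.elim (fun i : I => a i) (fun i => g (b i))) :=
    hbb'.sumElim_right (fun x hx => Or.inl (Or.inl hx)) fun i => Or.inl (Or.inr ⟨i, rfl⟩)
  have h4 : C.TupleEquivOver M₀.set (Sum.elim (fun i : I => f (a i)) b')
      (Sum.elim (fun i : I => f (a i)) (fun i => g (b i))) :=
    hbb'.sumElim_right (fun x hx => Or.inl (Or.inl hx)) fun i => Or.inr ⟨i, rfl⟩
  have h5 : C.TupleEquivOver M₀.set (Sum.elim (fun i : I => a i) b')
      (Sum.elim (fun i : I => f (a i)) b') :=
    TupleEquivOver.sumElim_left (D := M.set) ⟨f, hf, fun _ => rfl⟩ hM₀ hb'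
  rw [show N₀.set = Set.range b from hb.symm]
  exact (h1.trans (h3.symm.trans (h5.trans (h4.trans h2.symm)))).of_sumElim_right

/-- Symmetry for models gives the conclusion for a conjugate of `A`, and uniqueness brings the
conjugate back to `A` over `N`. -/
theorem coheir_hasSymmetry (hreg : κ.IsRegular) (hLS : K.LS < κ)
    (hord : ¬ C.WeakOrderProperty κ) (hE : C.HasE (C.Coheir κ) (C.ModelsGE κ))
    (hU : C.HasUniqueness (C.Coheir κ) (C.ModelsGE κ)) :
    C.HasSymmetry (C.Coheir κ) (C.ModelsGE κ) := by
  intro A M N hM h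
  refine ⟨?_, ?_⟩
  swap
  · rintro M' hM' rfl
    exact h.symm_of_model hreg hLS hord hE hM hM'
  have hind := isIndependenceRelation_coheir (C := C) (κ := κ)
  have := h.1
  obtain ⟨M', hMM', hAM'⟩ := exists_model_superset A M
  obtain ⟨f, hf, hfN⟩ := hE.exists_copy N.set hM hMM'
  have hMN : M ≤ N.map f := (Model.map_of_fixes hf).symm.le.trans (Model.map_mono f h.2.1)
  have h1 : C.Coheir κ M'.set M (N.map f) :=
    Coheir.symm_of_model hreg hLS hord hE (N := M') hM hMN hfN
  have h2 : C.Coheir κ (f.symm '' A) M N := by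
    have := hind.map (hind.monotonicity h1 hAM' hMN le_rfl) f.symm
    rwa [Model.map_of_fixes (Fixes.symm hf), show (N.map f).map f.symm = N from
      Model.set_injective (symm_image_image f N.set)] at this
  obtain ⟨g, hg, -, hgA⟩ := hU _ _ M N hM h h2 f.symm (Fixes.symm hf) rfl
  -- This automorphism fixes `M` and `A` pointwise and sends `f x` to `x` for `x` in `N`, so it
  -- carries the independence of `f '' N` from `M'` to that of `N` from a model containing `A`.
  let k : C.carrier ≃[L] C.carrier := g.symm.comp f.symm
  have hkM : Fixes k M.set := fun x hx => by
    change g.symm (f.symm x) = x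
    rw [Fixes.symm hf x hx, Fixes.symm hg x (h.2.1 hx)]
  refine ⟨M'.map k, (Model.map_of_fixes hkM).symm.le.trans (Model.map_mono k hMM'), ?_, ?_⟩
  · intro x hx
    refine ⟨x, hAM' hx, ?_⟩
    change g.symm (f.symm x) = x
    rw [← hgA x hx, g.symm_apply_apply]
  · have := hind.map hfN k
    rw [Model.map_of_fixes hkM] at this
    convert this using 1
    rw [Set.image_image]
    ext x
    constructor
    · intro hx
      refine ⟨x, hx, ?_⟩
      change g.symm (f.symm (f x)) = x
      rw [f.symm_apply_apply, Fixes.symm hg x hx]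
    · rintro ⟨y, hy, rfl⟩
      change g.symm (f.symm (f y)) ∈ _
      rwa [f.symm_apply_apply, Fixes.symm hg y hy]

/-! ### Counting types and local character -/

/-- Homogeneity, for two copies of the same model. -/
theorem exists_automorphism (hAP : K.Amalgamation) {N : Type u} [L.Structure N]
    (e e' : N ↪[L] C.carrier) (he : C.IsModel e.toHom.range) (he' : C.IsModel e'.toHom.range) :
    ∃ F : C.carrier ≃[L] C.carrier, ∀ x, F (e x) = e' x := by
  obtain ⟨F, hF⟩ := IsModelEquiv.exists_extension hAP
    (f := ⟨_, _, e'.equivRange.comp e.equivRange.symm⟩) ⟨he, he'⟩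
  refine ⟨F, fun x => ?_⟩
  have h1 := hF (e.equivRange x)
  rw [FirstOrder.Language.Embedding.equivRange_apply] at h1
  rw [h1]
  change ((e'.equivRange (e.equivRange.symm (e.equivRange x)) : _) : C.carrier) = _
  rw [FirstOrder.Language.Equiv.symm_apply_apply,
    FirstOrder.Language.Embedding.equivRange_apply]

/-- Some small set contains a copy of every set of size at most `κ`. -/
theorem exists_universal_set (hAP : K.Amalgamation) (C : K.MonsterModel) (hLS : K.LS < κ) :
    ∃ D : Set C.carrier, Small.{u} D ∧ ∀ A : Set C.carrier, #A ≤ Cardinal.lift.{u + 1} κ →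
      ∃ g : C.carrier ≃[L] C.carrier, g '' A ⊆ D := by
  -- Stage `κ.ord` has size at least `κ`, so `A` together with it lies in a model `Q` of the same
  -- size. Universality embeds `Q` into the next stage, and homogeneity extends this embedding to an
  -- automorphism.
  refine ⟨C.chain (Order.succ κ.ord), (isModel_chain _).small, fun A hA => ?_⟩
  have := small_of_card_le hA
  let M : C.Model := ⟨C.chain κ.ord, isModel_chain _⟩
  obtain ⟨Q', hMQ', hAQ'⟩ := exists_model_superset A M
  obtain ⟨Q, -, hQ, hcQ⟩ := exists_model_LS Q' (A := A ∪ M.set) (Set.union_subset hAQ' hMQ')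
  have hκM : Cardinal.lift.{u + 1} κ ≤ #M.set := lift_card_le_chain κ le_rfl
  have hinf : ℵ₀ ≤ #M.set :=
    (Cardinal.aleph0_le_lift.2 (K.LS_spec.1.trans hLS.le)).trans hκM
  have hcQM : #Q.set ≤ #M.set := hcQ.trans (Cardinal.add_le_of_le hinf
    ((Cardinal.mk_union_le _ _).trans (Cardinal.add_le_of_le hinf (hA.trans hκM) le_rfl))
    ((Cardinal.lift_le.2 hLS.le).trans hκM))
  obtain ⟨N₁, _, e₁, he₁, -⟩ := (M.2.strongIn_of_le M.2 le_rfl).exists_copy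
  obtain ⟨N₂, _, e₂, he₂, -⟩ := (Q.2.strongIn_of_le Q.2 le_rfl).exists_copy
  have hMQ : K.StrongIn M.1 Q.1 := M.2.strongIn_of_le Q.2 (Set.subset_union_right.trans hQ)
  obtain ⟨j, hj, hje⟩ := (he₁.symm ▸ he₂.symm ▸ hMQ :
    K.StrongIn e₁.toHom.range e₂.toHom.range).isKEmbedding
  have hcard : ∀ {N : Type u} [L.Structure N] (e : N ↪[L] C.carrier) (P : C.Model),
      e.toHom.range = P.1 → Cardinal.lift.{u + 1} #N = #P.set := by
    intro N _ e P he
    have h2 := Cardinal.mk_congr_lift.{u, u + 1} e.equivRange.toEquiv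
    rw [Cardinal.lift_id'.{u, u + 1}, he] at h2
    exact h2
  have hN : #N₂ < Order.succ #N₁ := by
    rw [Order.lt_succ_iff, ← Cardinal.lift_le.{u + 1}, hcard e₁ M he₁, hcard e₂ Q he₂]
    exact hcQM
  obtain ⟨h, hh, hhe⟩ := C.universal κ.ord N₁ N₂ e₁ j he₁ hj hN
  obtain ⟨F, hF⟩ := exists_automorphism hAP e₂ h (he₂.symm ▸ Q.2)
    (IsModel.of_strongIn hh (isModel_chain _))
  refine ⟨F, ?_⟩
  rintro _ ⟨x, hx, rfl⟩
  have hxQ : x ∈ e₂.toHom.range := he₂.symm ▸ hQ (Or.inl hx)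
  obtain ⟨y, rfl⟩ := hxQ
  exact hh.le (by
    change F (e₂ y) ∈ _
    rw [hF]
    exact h.toHom.mem_range_self y)

/-- Padding with a point of `X` lets one fixed index type serve for all small sets. -/
theorem exists_cover {X P : Set C.carrier} (hPX : P ⊆ X) (hX : X.Nonempty) {ι : Type u}
    (hP : #P ≤ Cardinal.lift.{u + 1} #ι) :
    ∃ s : ι → C.carrier, (∀ i, s i ∈ X) ∧ P ⊆ Set.range s := by
  classical
  rw [← Cardinal.lift_id'.{u, u + 1} #P, Cardinal.lift_mk_le'] at hP
  obtain ⟨e⟩ := hP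
  obtain ⟨x₀, hx₀⟩ := hX
  refine ⟨fun i => if h : ∃ p, e p = i then (h.choose : C.carrier) else x₀, fun i => ?_, ?_⟩
  · dsimp only
    split_ifs with h
    · exact hPX h.choose.2
    · exact hx₀
  · intro p hp
    have h : ∃ q, e q = e ⟨p, hp⟩ := ⟨_, rfl⟩
    refine ⟨e ⟨p, hp⟩, ?_⟩
    dsimp only
    rw [dif_pos h, e.injective h.choose_spec]

/-- One closing-off step in the construction of a small base for coheir. -/
theorem exists_realizing_models (hreg : κ.IsRegular) (hLS : K.LS < κ) {χ : Cardinal.{u}}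
    (hκχ : κ ≤ χ) (hχ : χ ^ κ ≤ χ) {D : Set C.carrier} (hcD : #D ≤ Cardinal.lift.{u + 1} χ)
    (hD : ∀ A : Set C.carrier, #A ≤ Cardinal.lift.{u + 1} κ →
      ∃ g : C.carrier ≃[L] C.carrier, g '' A ⊆ D)
    {N N' : C.Model} (hNN' : N ≤ N') {X : Set C.carrier} (hX : X ⊆ N'.set) (hXne : X.Nonempty)
    (hcX : #X ≤ Cardinal.lift.{u + 1} χ) :
    ∃ M M' : C.Model, M ≤ N ∧ M' ≤ N' ∧ M ≤ M' ∧ X ∩ N.set ⊆ M.set ∧ X ⊆ M'.set ∧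
      #M'.set ≤ Cardinal.lift.{u + 1} χ ∧
      ∀ P : Set C.carrier, P ⊆ X → #P < Cardinal.lift.{u + 1} κ →
        ∀ A : Set C.carrier, A ⊆ N.set → #A < Cardinal.lift.{u + 1} κ →
          ∃ B : Set C.carrier, B ⊆ M.set ∧ C.SetEquivOver P B A := by
  classical
  obtain ⟨ι, hι⟩ : ∃ ι : Type u, #ι = κ := ⟨κ.out, κ.mk_out⟩
  have hinf : ℵ₀ ≤ Cardinal.lift.{u + 1} χ :=
    Cardinal.aleph0_le_lift.2 (hreg.aleph0_le.trans hκχ)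
  have hLSχ : Cardinal.lift.{u + 1} K.LS ≤ Cardinal.lift.{u + 1} χ :=
    Cardinal.lift_le.2 (hLS.le.trans hκχ)
  -- A type over a tuple `x` from `X` is coded by `x` and a copy in `D` of `x` followed by a
  -- realization. There are at most `χ ^ κ ≤ χ` codes, and one realization in `N` is kept for each
  -- code that has one.
  let good : (ι → X) × (ι ⊕ ι → D) → (ι → C.carrier) → Prop := fun p w =>
    (∀ i, w i ∈ N.set) ∧ C.TupleEquivOver ∅ (Sum.elim (fun i => (p.1 i : C.carrier)) w)
      (fun i => (p.2 i : C.carrier))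
  let r : (ι → X) × (ι ⊕ ι → D) → Set C.carrier := fun p =>
    if h : ∃ w, good p w then Set.range h.choose else ∅
  have hr : ∀ p, r p ⊆ N.set ∧ #(r p) ≤ Cardinal.lift.{u + 1} χ := by
    intro p
    by_cases h : ∃ w, good p w
    · simp only [r, dif_pos h]
      refine ⟨Set.range_subset_iff.2 h.choose_spec.1, ?_⟩
      have := Cardinal.mk_range_le_lift.{u, u + 1} (f := h.choose)
      rw [Cardinal.lift_id'.{u, u + 1}, hι] at this
      exact this.trans (Cardinal.lift_le.2 hκχ)
    · simp only [r, dif_neg h]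
      exact ⟨Set.empty_subset _, by simp⟩
  let Y : Set C.carrier := ⋃ p, r p
  have hYN : Y ⊆ N.set := Set.iUnion_subset fun p => (hr p).1
  have hpow : Cardinal.lift.{u + 1} χ ^ Cardinal.lift.{u + 1} κ ≤ Cardinal.lift.{u + 1} χ := by
    rw [← Cardinal.lift_power]
    exact Cardinal.lift_le.2 hχ
  have hfun : ∀ {S : Set C.carrier}, #S ≤ Cardinal.lift.{u + 1} χ →
      #(ι → S) ≤ Cardinal.lift.{u + 1} χ := by
    intro S hS
    rw [Cardinal.mk_arrow, hι, Cardinal.lift_id'.{u, u + 1}]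
    exact (Cardinal.power_le_power_right hS).trans hpow
  have hfun2 : #(ι ⊕ ι → D) ≤ Cardinal.lift.{u + 1} χ := by
    rw [Cardinal.mk_congr (Equiv.sumArrowEquivProdArrow ι ι D), ← Cardinal.mul_def]
    exact Cardinal.mul_le_of_le hinf (hfun hcD) (hfun hcD)
  have hcY : #Y ≤ Cardinal.lift.{u + 1} χ := by
    refine (Cardinal.mk_iUnion_le _).trans (Cardinal.mul_le_of_le hinf ?_ ?_)
    · rw [Cardinal.mk_prod, Cardinal.lift_id, Cardinal.lift_id]
      exact Cardinal.mul_le_of_le hinf (hfun hcX) hfun2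
    · exact ciSup_le' fun p => (hr p).2
  obtain ⟨M, hM, hYM, hcM⟩ := exists_model_LS N (A := Y ∪ (X ∩ N.set))
    (Set.union_subset hYN Set.inter_subset_right)
  obtain ⟨M', hM', hXM', hcM'⟩ := exists_model_LS N' (A := M.set ∪ X)
    (Set.union_subset (hM.trans hNN') hX)
  have hcM : #M.set ≤ Cardinal.lift.{u + 1} χ := hcM.trans (Cardinal.add_le_of_le hinf
    ((Cardinal.mk_union_le _ _).trans (Cardinal.add_le_of_le hinf hcY
      ((Cardinal.mk_le_mk_of_subset Set.inter_subset_left).trans hcX))) hLSχ)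
  refine ⟨M, M', hM, hM', Set.subset_union_left.trans hXM', Set.subset_union_right.trans hYM,
    Set.subset_union_right.trans hXM', hcM'.trans (Cardinal.add_le_of_le hinf
      ((Cardinal.mk_union_le _ _).trans (Cardinal.add_le_of_le hinf hcM hcX)) hLSχ), ?_⟩
  intro P hP hcP A hA hcA
  rcases A.eq_empty_or_nonempty with rfl | hAne
  · exact ⟨∅, Set.empty_subset _, FirstOrder.Language.Equiv.refl L _, fun _ _ => rfl,
      Set.image_empty _⟩
  obtain ⟨s, hs, hPs⟩ := exists_cover hP hXne (hcP.le.trans_eq (congrArg _ hι.symm))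
  obtain ⟨w, hw, hAw⟩ := exists_cover subset_rfl hAne (hcA.le.trans_eq (congrArg _ hι.symm))
  have hwA : Set.range w = A := (Set.range_subset_iff.2 hw).antisymm hAw
  obtain ⟨g, hg⟩ := hD (Set.range (Sum.elim s w)) (by
    have := Cardinal.mk_range_le_lift.{u, u + 1} (f := Sum.elim s w)
    rw [Cardinal.lift_id'.{u, u + 1}, Cardinal.mk_sum, Cardinal.lift_id, hι,
      Cardinal.add_eq_self hreg.aleph0_le] at this
    exact this)
  let p : (ι → X) × (ι ⊕ ι → D) := (fun i => ⟨s i, hs i⟩, fun i => ⟨g (Sum.elim s w i),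
    hg ⟨_, ⟨i, rfl⟩, rfl⟩⟩)
  have hp : ∃ w, good p w := ⟨w, fun i => hA (hw i), g, fun _ h => absurd h (Set.notMem_empty _),
    fun i => rfl⟩
  have hrp : r p = Set.range hp.choose := dif_pos hp
  refine ⟨r p, (Set.subset_iUnion r p).trans (Set.subset_union_left.trans hYM), ?_⟩
  rw [hrp, ← hwA]
  have h1 : C.TupleEquivOver ∅ (Sum.elim s hp.choose) (Sum.elim s w) :=
    hp.choose_spec.2.trans (TupleEquivOver.symm ⟨g, fun _ h => absurd h (Set.notMem_empty _),
      fun i => rfl⟩)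
  exact (h1.of_sumElim_left.mono hPs).setEquivOver

/-- Fewer than `μ` stages below `μ.ord` are bounded below `μ.ord`, by regularity. -/
theorem exists_subset_of_monotone {μ : Cardinal.{u}} (hμ : μ.IsRegular)
    (s : Set.Iio μ.ord → Set C.carrier) (hs : Monotone s) {A : Set C.carrier}
    (hA : A ⊆ ⋃ i, s i) (hc : #A < Cardinal.lift.{u + 1} μ) : ∃ i, A ⊆ s i := by
  obtain ⟨α, a, rfl, hα⟩ := exists_enumeration_lt hc
  have h : ∀ i, ∃ j, a i ∈ s j := fun i => Set.mem_iUnion.1 (hA ⟨i, rfl⟩)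
  choose j hj using h
  have hlt := Ordinal.iSup_lt_of_lt_cof (hα.trans_eq hμ.cof_ord.symm) (f := fun i => (j i).1)
    fun i => (j i).2
  refine ⟨⟨_, hlt⟩, ?_⟩
  rintro _ ⟨i, rfl⟩
  exact hs (show j i ≤ ⟨_, hlt⟩ from le_ciSup Ordinal.bddAbove_of_small i) (hj i)

theorem mem_set_iSup {ι : Type*} [LinearOrder ι] [Nonempty ι] {M : ι → L.Substructure C.carrier}
    (hM : Monotone M) {x : C.carrier} : x ∈ (⨆ i, M i) ↔ ∃ i, x ∈ M i :=
  Substructure.mem_iSup_of_directed hM.directed_le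

/-- Every set is independent from every model over a submodel of bounded size. -/
theorem Coheir.exists_small_base (hAP : K.Amalgamation) (hreg : κ.IsRegular) (hLS : K.LS < κ)
    (hord : ¬ C.WeakOrderProperty κ) (hE : C.HasE (C.Coheir κ) (C.ModelsGE κ))
    (α : Cardinal.{u}) :
    ∃ χ : Cardinal.{u}, κ ≤ χ ∧ ∀ A : Set C.carrier, #A ≤ Cardinal.lift.{u + 1} α →
      ∀ N ∈ C.ModelsGE κ, ∃ M : C.Model, M ≤ N ∧ M ∈ C.ModelsGE κ ∧
        #M.set ≤ Cardinal.lift.{u + 1} χ ∧ C.Coheir κ A M N := by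
  obtain ⟨D, hDs, hD⟩ := exists_universal_set hAP C hLS
  let θ := max κ (max α #(Shrink.{u} D))
  -- A power of two with exponent at least `κ` satisfies `χ ^ κ = χ`, as the count of types
  -- requires.
  let χ : Cardinal.{u} := 2 ^ θ
  have hθχ : θ ≤ χ := (Cardinal.cantor θ).le
  have hκθ : κ ≤ θ := le_max_left _ _
  have hκχ : κ ≤ χ := hκθ.trans hθχ
  have hχ : χ ^ κ ≤ χ := by
    rw [← Cardinal.power_mul, Cardinal.mul_eq_left (hreg.aleph0_le.trans hκθ) hκθ hreg.pos.ne']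
  have hcD : #D ≤ Cardinal.lift.{u + 1} χ := by
    have := Cardinal.mk_congr_lift.{u + 1, u} (equivShrink.{u} D)
    rw [Cardinal.lift_id'.{u, u + 1}] at this
    rw [this]
    exact Cardinal.lift_le.2 (((le_max_right _ _).trans (le_max_right _ _)).trans hθχ)
  have hαχ : α ≤ χ := ((le_max_left _ _).trans (le_max_right _ _)).trans hθχ
  have hinf : ℵ₀ ≤ Cardinal.lift.{u + 1} χ :=
    Cardinal.aleph0_le_lift.2 (hreg.aleph0_le.trans hκχ)
  refine ⟨χ, hκχ, fun A hA N hN => ?_⟩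
  have := small_of_card_le hA
  obtain ⟨N', hNN', hAN'⟩ := exists_model_superset A N
  -- These `κ` points of `N` are put into the base so that it has size at least `κ`.
  obtain ⟨N₀, hN₀, hcN₀⟩ := Cardinal.le_mk_iff_exists_subset.1 (show _ ≤ _ from hN)
  have hN₀ne : N₀.Nonempty := by
    rw [← Set.nonempty_coe_sort, ← Cardinal.mk_ne_zero_iff, hcN₀]
    simpa using hreg.pos.ne'
  have : Nonempty (C.Model × C.Model) := ⟨(N, N)⟩
  obtain ⟨F, hF⟩ := exists_wellFounded_rec (ι := Ordinal.{u}) (X := C.Model × C.Model)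
    (fun i g x => i < κ.ord → x.1 ≤ N ∧ x.2 ≤ N' ∧ x.1 ≤ x.2 ∧
      ((A ∪ N₀) ∪ ⋃ (j) (hj), (g j hj).2.set) ∩ N.set ⊆ x.1.set ∧
      ((A ∪ N₀) ∪ ⋃ (j) (hj), (g j hj).2.set) ⊆ x.2.set ∧
      #x.2.set ≤ Cardinal.lift.{u + 1} χ ∧
      ∀ P : Set C.carrier, P ⊆ ((A ∪ N₀) ∪ ⋃ (j) (hj), (g j hj).2.set) →
        #P < Cardinal.lift.{u + 1} κ →
        ∀ A : Set C.carrier, A ⊆ N.set → #A < Cardinal.lift.{u + 1} κ →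
          ∃ B : Set C.carrier, B ⊆ x.1.set ∧ C.SetEquivOver P B A) (by
    intro i g hg
    by_cases hi : i < κ.ord
    swap
    · exact ⟨(N, N), fun h => absurd h hi⟩
    obtain ⟨M, M', h⟩ := exists_realizing_models hreg hLS hκχ hχ hcD hD hNN'
      (X := (A ∪ N₀) ∪ ⋃ (j) (hj), (g j hj).2.set)
      (Set.union_subset (Set.union_subset hAN' (hN₀.trans hNN'))
        (Set.iUnion₂_subset fun j hj => (hg j hj (hj.trans hi)).2.1))
      (hN₀ne.mono (Set.subset_union_right.trans Set.subset_union_left)) (by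
        refine (Cardinal.mk_union_le _ _).trans (Cardinal.add_le_of_le hinf
          ((Cardinal.mk_union_le _ _).trans (Cardinal.add_le_of_le hinf
            (hA.trans (Cardinal.lift_le.2 hαχ)) (hcN₀.trans_le (Cardinal.lift_le.2 hκχ)))) ?_)
        have h1 : (⋃ (j) (hj), (g j hj).2.set) = ⋃ j : Set.Iio i, (g j.1 j.2).2.set := by
          ext x; simp
        rw [h1]
        refine (Cardinal.mk_iUnion_le _).trans (Cardinal.mul_le_of_le hinf ?_
          (ciSup_le' fun j => (hg j.1 j.2 (j.2.trans hi)).2.2.2.2.2.1))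
        rw [Cardinal.mk_Iio_ordinal]
        exact Cardinal.lift_le.2 ((Cardinal.lt_ord.1 hi).le.trans hκχ))
    exact ⟨(M, M'), fun _ => h⟩)
  have hM2 : ∀ {i j}, j < i → i < κ.ord → (F j).2 ≤ (F i).2 := fun hji hi =>
    Model.set_subset.1 fun x hx =>
      (hF _ hi).2.2.2.2.1 (Or.inr (Set.mem_iUnion₂.2 ⟨_, hji, hx⟩))
  have hM1 : ∀ {i j}, j < i → i < κ.ord → (F j).1 ≤ (F i).1 := fun hji hi =>
    Model.set_subset.1 fun x hx => (hF _ hi).2.2.2.1 ⟨Or.inr (Set.mem_iUnion₂.2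
      ⟨_, hji, (hF _ (hji.trans hi)).2.2.1 hx⟩), (hF _ (hji.trans hi)).1 hx⟩
  have : Nonempty (Set.Iio κ.ord) := ⟨⟨0, hreg.ord_pos⟩⟩
  have hm1 : Monotone fun i : Set.Iio κ.ord => (F i).1.1 := by
    intro i j hij
    rcases eq_or_lt_of_le hij with rfl | h
    · exact le_rfl
    · exact hM1 h j.2
  have hm2 : Monotone fun i : Set.Iio κ.ord => (F i).2.1 := by
    intro i j hij
    rcases eq_or_lt_of_le hij with rfl | h
    · exact le_rfl
    · exact hM2 h j.2
  let M : C.Model := ⟨⨆ i : Set.Iio κ.ord, (F i).1.1, isModel_iSup _ hm1 fun i => (F i).1.2⟩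
  let M' : C.Model := ⟨⨆ i : Set.Iio κ.ord, (F i).2.1, isModel_iSup _ hm2 fun i => (F i).2.2⟩
  have hM'set : M'.set = ⋃ i : Set.Iio κ.ord, (F i).2.set := by
    ext x
    exact (mem_set_iSup hm2).trans Set.mem_iUnion.symm
  have hMN : M ≤ N := show M.1 ≤ N.1 from iSup_le fun i => (hF i.1 i.2).1
  have hMM' : M ≤ M' := show M.1 ≤ M'.1 from iSup_mono fun i => (hF i.1 i.2).2.2.1
  have hle1 : ∀ i < κ.ord, (F i).1 ≤ M := fun i hi =>
    le_iSup (fun i : Set.Iio κ.ord => (F i).1.1) ⟨i, hi⟩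
  have hle2 : ∀ i < κ.ord, (F i).2 ≤ M' := fun i hi =>
    le_iSup (fun i : Set.Iio κ.ord => (F i).2.1) ⟨i, hi⟩
  have hAM' : A ⊆ M'.set := fun x hx =>
    hle2 0 hreg.ord_pos ((hF 0 hreg.ord_pos).2.2.2.2.1 (Or.inl (Or.inl hx)))
  have hMκ : M ∈ C.ModelsGE κ := by
    refine hcN₀.symm.le.trans (Cardinal.mk_le_mk_of_subset fun x hx => ?_)
    exact hle1 0 hreg.ord_pos ((hF 0 hreg.ord_pos).2.2.2.1 ⟨Or.inl (Or.inr hx), hN₀ hx⟩)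
  have hcM : #M.set ≤ Cardinal.lift.{u + 1} χ := by
    refine (Cardinal.mk_le_mk_of_subset (Model.set_subset.2 hMM')).trans ?_
    rw [hM'set]
    refine (Cardinal.mk_iUnion_le _).trans (Cardinal.mul_le_of_le hinf ?_
      (ciSup_le' fun i => (hF i i.2).2.2.2.2.2.1))
    rw [Cardinal.mk_Iio_ordinal, Cardinal.card_ord]
    exact Cardinal.lift_le.2 hκχ
  -- A small submodel of `M'` lies in some stage `i`, and stage `i + 1` put into `M` realizations of
  -- the types over it of small subsets of `N`.
  have hNM : C.Coheir κ N.set M M' := by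
    refine ⟨inferInstance, hMM', fun A₀ hA₀ hcA₀ P hP hcP => ?_⟩
    obtain ⟨i, hi⟩ := exists_subset_of_monotone hreg (fun i : Set.Iio κ.ord => (F i).2.set) hm2
      (hM'set ▸ hP : P.set ⊆ _) hcP
    have hsucc : Order.succ i.1 < κ.ord :=
      (Cardinal.isSuccLimit_ord hreg.aleph0_le).succ_lt i.2
    obtain ⟨B, hB, hBA⟩ := (hF _ hsucc).2.2.2.2.2.2 P.set (fun x hx =>
      Or.inr (Set.mem_iUnion₂.2 ⟨i.1, Order.lt_succ _, hi hx⟩)) hcP A₀ hA₀ hcA₀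
    exact ⟨B, hB.trans (hle1 _ hsucc), hBA⟩
  exact ⟨M, hMN, hMκ, hcM, isIndependenceRelation_coheir.monotonicity
    (Coheir.symm_of_model hreg hLS hord hE hMκ hMN hNM) hAM' hMN le_rfl⟩

/-- A base of size at most `χ` for `A` inside the union is swallowed by some stage of a chain of
regular length above `χ`, and base monotonicity applies. -/
theorem coheir_hasLocalCharacter (hAP : K.Amalgamation) (hreg : κ.IsRegular) (hLS : K.LS < κ)
    (hord : ¬ C.WeakOrderProperty κ) (hE : C.HasE (C.Coheir κ) (C.ModelsGE κ)) :
    C.HasLocalCharacter (C.Coheir κ) (C.ModelsGE κ) := by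
  intro α
  obtain ⟨χ, hκχ, h⟩ := Coheir.exists_small_base hAP hreg hLS hord hE α
  refine ⟨Order.succ χ, Cardinal.isRegular_succ (hreg.aleph0_le.trans hκχ), ?_⟩
  intro μ hμ hχμ M hM hM𝓑 A hA
  have hMμ : M μ.ord ∈ C.ModelsGE κ :=
    ModelsGE.mono (hM𝓑 0 hμ.ord_pos) (hM.1 0 _ zero_le le_rfl)
  obtain ⟨P, hP, -, hcP, hAM⟩ := h A hA.le _ hMμ
  have hm : Monotone fun i : Set.Iio μ.ord => (M i).1 := fun i j hij =>
    hM.1 _ _ hij (le_of_lt j.2)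
  have : Nonempty (Set.Iio μ.ord) := ⟨⟨0, hμ.ord_pos⟩⟩
  obtain ⟨i, hi⟩ := exists_subset_of_monotone hμ (fun i : Set.Iio μ.ord => (M i).set) hm
    (A := P.set) (fun x hx => by
      have hx' : x ∈ (M μ.ord).1 := hP hx
      rw [hM.2 _ le_rfl (Cardinal.isSuccLimit_ord hμ.aleph0_le)] at hx'
      exact Set.mem_iUnion.2 ((mem_set_iSup hm).1 hx'))
    (hcP.trans_lt (Cardinal.lift_lt.2 ((Order.lt_succ χ).trans_le hχμ)))
  exact ⟨i, i.2, isIndependenceRelation_coheir.base_monotonicity hAM hi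
    (hM.1 _ _ (le_of_lt i.2) le_rfl)⟩

/-! ### Canonicity -/

/-- A map sending each model to a larger one can be iterated along a continuous chain. -/
theorem exists_continuous_chain (N : C.Model) (next : C.Model → C.Model)
    (hnext : ∀ P, P ≤ next P) :
    ∃ M : Ordinal.{u} → C.Model, (∀ δ, C.IsContinuousChain δ M) ∧ (∀ i, N ≤ M i) ∧
      ∀ i, next (M i) ≤ M (Order.succ i) := by
  have : Nonempty C.Model := ⟨N⟩
  obtain ⟨M, hM⟩ := exists_wellFounded_rec (ι := Ordinal.{u}) (X := C.Model)
    (fun i g x => N ≤ x ∧ (∀ j hj, g j hj ≤ x) ∧ (∀ j (hj : j < i), i = Order.succ j →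
      next (g j hj) ≤ x) ∧ (Order.IsSuccLimit i → x.1 = ⨆ j : Set.Iio i, (g j.1 j.2).1)) (by
    intro i g hg
    rcases Ordinal.zero_or_succ_or_isSuccLimit i with rfl | ⟨j, rfl⟩ | hi
    · exact ⟨N, le_rfl, fun j hj => absurd hj not_lt_zero, fun j hj => absurd hj not_lt_zero,
        fun h => absurd h.1 (by simp)⟩
    · have hj : j < Order.succ j := Order.lt_succ j
      refine ⟨next (g j hj), (hg j hj).1.trans (hnext _), fun k hk => ?_, fun k hk hkj => ?_,
        fun h => absurd h.2 (Order.not_isSuccPrelimit_succ j)⟩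
      · rcases eq_or_lt_of_le (Order.lt_succ_iff.1 hk) with rfl | hkj
        · exact hnext _
        · exact ((hg j hj).2.1 k hkj).trans (hnext _)
      · obtain rfl := Order.succ_injective hkj
        exact le_rfl
    · have hm : Monotone fun j : Set.Iio i => (g j.1 j.2).1 := by
        rintro ⟨j, hj⟩ ⟨k, hk⟩ hjk
        rcases eq_or_lt_of_le hjk with h | h
        · cases h; exact le_rfl
        · exact (hg k hk).2.1 j h
      have h0 : 0 < i := pos_iff_ne_zero.2 (by rintro rfl; exact hi.1 (by simp))
      have : Nonempty (Set.Iio i) := ⟨⟨0, h0⟩⟩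
      have hle : ∀ j hj, (g j hj).1 ≤ ⨆ j : Set.Iio i, (g j.1 j.2).1 := fun j hj =>
        le_iSup (fun j : Set.Iio i => (g j.1 j.2).1) ⟨j, hj⟩
      refine ⟨⟨_, isModel_iSup _ hm fun j => (g j.1 j.2).2⟩, ?_, hle, fun j hj hij => ?_,
        fun _ => rfl⟩
      · exact (show N.1 ≤ _ from (hg 0 h0).1).trans (hle 0 h0)
      · exact absurd (hij ▸ hi).2 (Order.not_isSuccPrelimit_succ j))
  refine ⟨M, fun δ => ⟨fun i j hij _ => ?_, fun i _ hi => (hM i).2.2.2 hi⟩, fun i => (hM i).1,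
    fun i => (hM _).2.2.1 i (Order.lt_succ i) rfl⟩
  rcases eq_or_lt_of_le hij with rfl | h
  · exact le_rfl
  · exact (hM j).2.1 i h

/-- An independence relation with extension and uniqueness is contained in coheir. -/
theorem IsIndependenceRelation.coheir {R : C.TernaryRel} (hR : C.IsIndependenceRelation R)
    (hRE : C.HasE R (C.ModelsGE κ)) (hRU : C.HasUniqueness R (C.ModelsGE κ))
    (hreg : κ.IsRegular) (hLS : K.LS < κ) (hord : ¬ C.WeakOrderProperty κ)
    (hE : C.HasE (C.Coheir κ) (C.ModelsGE κ))
    (hT : C.HasRightTransitivity (C.Coheir κ) (C.ModelsGE κ))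
    (hS : C.HasSymmetry (C.Coheir κ) (C.ModelsGE κ))
    (hlc : C.HasLocalCharacter (C.Coheir κ) (C.ModelsGE κ))
    {A : Set C.carrier} {M N : C.Model} (hM : M ∈ C.ModelsGE κ) (h : R A M N) :
    C.Coheir κ A M N := by
  have hind := isIndependenceRelation_coheir (C := C) (κ := κ)
  obtain ⟨hAs, hMN⟩ := hR.dom h
  -- Each step of the chain adds a copy of `N` over `M` that is coheir-independent from the previous
  -- stage.
  have hnext : ∀ P : C.Model, ∃ Q : C.Model, P ≤ Q ∧ (M ≤ P → ∃ f : C.carrier ≃[L] C.carrier,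
      Fixes f M.set ∧ N.map f ≤ Q ∧ C.Coheir κ (N.map f).set M P) := by
    intro P
    by_cases hMP : M ≤ P
    · obtain ⟨f, hf, hfN⟩ := hE.exists_copy N.set hM hMP
      obtain ⟨Q, hPQ, hQ⟩ := exists_model_superset (N.map f).set P
      exact ⟨Q, hPQ, fun _ => ⟨f, hf, hQ, hfN⟩⟩
    · exact ⟨P, le_rfl, fun h => absurd h hMP⟩
  choose next hle hcopy using hnext
  obtain ⟨Ch, hCh, hNCh, hsucc⟩ := exists_continuous_chain N next hle
  obtain ⟨l, hl, hloc⟩ := hlc #(Shrink.{u} A)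
  obtain ⟨A', ⟨f, hf, rfl⟩, hA'⟩ := hRE.2 A M N (Ch l.ord) hM hMN (hNCh _) h
  have hcA : #A' = Cardinal.lift.{u + 1} #(Shrink.{u} (f '' A')) := by
    have := Cardinal.mk_congr_lift.{u + 1, u} (equivShrink.{u} (f '' A'))
    rw [Cardinal.lift_id'.{u, u + 1}] at this
    rw [← this, Cardinal.mk_image_eq f.injective]
  obtain ⟨i, hi, hAi⟩ := hloc l hl le_rfl Ch (hCh _)
    (fun j _ => ModelsGE.mono hM (hMN.trans (hNCh j))) A' hcA
  have hMi : M ≤ Ch i := hMN.trans (hNCh i)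
  obtain ⟨g, hg, hgN, hgi⟩ := hcopy (Ch i) hMi
  have hgCh : N.map g ≤ Ch l.ord := hgN.trans ((hsucc i).trans
    ((hCh l.ord).1 _ _ (Order.succ_le_of_lt hi) le_rfl))
  have hMg : M ≤ N.map g := (Model.map_of_fixes hg).symm.le.trans (Model.map_mono g hMN)
  -- The copy `N.map g` lies in the last model of the chain, so symmetry makes it independent over
  -- `Ch i` from a model `P` containing `A'`. Right transitivity lowers the base to `M`, and
  -- symmetry gives `A'` independent from the copy.
  obtain ⟨⟨P, hP, hAP, hChP⟩, -⟩ := hS A' (Ch i) (Ch l.ord) (ModelsGE.mono hM hMi) hAi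
  have hgP : C.Coheir κ (N.map g).set M P := hT _ M (Ch i) P hM hMi hP hgi
    (hind.monotonicity hChP hgCh hP le_rfl)
  have hAg : C.Coheir κ A' M (N.map g) := hind.monotonicity
    (Coheir.symm_of_model hreg hLS hord hE hM hMg hgP) hAP hMg le_rfl
  have hRN : R A' M N := hR.monotonicity hA' subset_rfl hMN (hNCh _)
  have hRg := hR.map hRN g
  rw [Model.map_of_fixes hg] at hRg
  -- By uniqueness of `R`, `A'` and `g '' A'` are conjugate over the copy of `N`.
  -- Coheir-independence therefore passes to `g '' A'`, and applying the inverse of `g` gives it for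
  -- `A'` and `N`.
  obtain ⟨k, hk, hkA, -⟩ := hRU A' (g '' A') M (N.map g) hM
    (hR.monotonicity hA' subset_rfl hMg hgCh) hRg g hg rfl
  have h1 := hind.map hAg k
  rw [hkA, Model.map_of_fixes hk, Model.map_of_fixes (fun x hx => hk x (hMg hx))] at h1
  have h2 : C.Coheir κ A' M N := (hind.invariance g rfl (image_of_fixes hg) rfl).2 h1
  have h3 := hind.map h2 f
  rwa [Model.map_of_fixes hf, Model.map_of_fixes (fun x hx => hf x (hMN hx))] at h3

/-- Comparable relations with extension and uniqueness, respectively, coincide. -/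
theorem IsIndependenceRelation.of_le {R S : C.TernaryRel} {𝓑 : Set C.Model}
    (hR : C.IsIndependenceRelation R) (hS : C.IsIndependenceRelation S)
    (hRE : C.HasE R 𝓑) (hSU : C.HasUniqueness S 𝓑)
    (hRS : ∀ {A M N}, M ∈ 𝓑 → R A M N → S A M N)
    {A : Set C.carrier} {M N : C.Model} (hM : M ∈ 𝓑) (h : S A M N) : R A M N := by
  obtain ⟨hA, hMN⟩ := hS.dom h
  -- The copy is independent in both senses, so uniqueness of `S` makes it conjugate to `A` over
  -- `N`, and invariance of `R` concludes.
  obtain ⟨f, hf, hfA⟩ := hRE.exists_copy A hM hMN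
  obtain ⟨g, hg, hgA, -⟩ := hSU A (f '' A) M N hM h (hRS hM hfA) f hf rfl
  exact (hR.invariance g hgA (image_of_fixes fun x hx => hg x (hMN hx))
    (image_of_fixes hg)).2 hfA

end MonsterModel
end AbstractElementaryClass

open AbstractElementaryClass MonsterModel

theorem theorem6p6 {L : FirstOrder.Language.{u, u}} (K : AbstractElementaryClass.{u} L)
    (hAP : K.Amalgamation) (hJEP : K.JointEmbedding) (hNMM : K.NoMaximalModels)
    (C : K.MonsterModel) (κ : Cardinal.{u}) (hreg : κ.IsRegular) (hLS : K.LS < κ)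
    (htame : C.FullyTame κ) (hshort : C.FullyTypeShort κ) (hord : ¬ C.WeakOrderProperty κ)
    (hE : C.HasE (C.Coheir κ) (C.ModelsGE κ)) :
    (C.HasContinuity (C.Coheir κ) (C.ModelsGE κ) κ ∧
      C.HasLeftTransitivity (C.Coheir κ) (C.ModelsGE κ) ∧
      C.HasRightTransitivity (C.Coheir κ) (C.ModelsGE κ) ∧
      C.HasSymmetry (C.Coheir κ) (C.ModelsGE κ) ∧
      C.HasUniqueness (C.Coheir κ) (C.ModelsGE κ) ∧
      C.HasLocalCharacter (C.Coheir κ) (C.ModelsGE κ)) ∧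
    ∀ R : C.TernaryRel, C.IsIndependenceRelation R →
      C.HasE R (C.ModelsGE κ) → C.HasUniqueness R (C.ModelsGE κ) →
      ∀ (A : Set C.carrier) (M N : C.Model), M ∈ C.ModelsGE κ →
        (R A M N ↔ C.Coheir κ A M N) := by
  have hind := isIndependenceRelation_coheir (C := C) (κ := κ)
  have hU := coheir_hasUniqueness hreg hLS htame hshort hord hE
  have hS := coheir_hasSymmetry hreg hLS hord hE hU
  have hT := hind.hasRightTransitivity hE hU
  have hlc := coheir_hasLocalCharacter hAP hreg hLS hord hE
  refine ⟨⟨coheir_hasContinuity _, coheir_hasLeftTransitivity _, hT, hS, hU, hlc⟩,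
    fun R hR hRE hRU A M N hM => ?_⟩
  have hle : ∀ {A : Set C.carrier} {M N : C.Model}, M ∈ C.ModelsGE κ → R A M N →
      C.Coheir κ A M N :=
    fun hM h => hR.coheir hRE hRU hreg hLS hord hE hT hS hlc hM h
  exact ⟨hle hM, hR.of_le hind hRE hU hle hM⟩
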